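/- Let $X$ and $Y$ be complex Hilbert spaces, with $Y\subset X$ continuously and densely embedded and normalised so that $\|y\|_X\le\|y\|_Y$ for $y\in Y$, and let $A(\cdot,\cdot)$ be a sesquilinear form on $Y$ with $\Re A(v,v)\ge c_0\|v\|_Y^2$ and $|A(u,v)|\le C_0\|u\|_Y\|v\|_Y$ for all $u,v\in Y$, where $c_0>0$. Let $T:X\to Y$ be its solution operator, $A(Tf,\phi)=(f,\phi)_X$ for all $\phi\in Y$, and let $A:=T^{-1}$ be the associated (regularly accretive) unbounded operator on $X$, with domain $D(A)=\mathrm{Range}(T)$. For $\beta\in(0,1)$ put $$A^{-\beta}f=\frac{\sin(\pi\beta)}{\pi}\int_0^\infty\mu^{-\beta}(\mu I+A)^{-1}f\,d\mu,\qquad f\in X.$$ For $r\ge0$ let $n=\lceil r\rceil$, $D(A^r)=\{x\in X: A^{r-n}x\in D(A^n)\}$, $A^rx=A^nA^{r-n}x$ (with $A^0=I$) and $\|x\|_{D(A^r)}=\|A^rx\|_X$. For $k>0$ and integers $M,N>0$ put $$\mathcal Q_k^{-\beta}(A)f=\frac{k\sin(\pi\beta)}{\pi}\sum_{\ell=-M}^{N}e^{(1-\beta)\ell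 k}\,(e^{\ell k}I+A)^{-1}f .$$ **Theorem (Sinc Quadrature Error).** Let $\beta\in(0,1)$, $s<\beta$ and $s^+=\max(0,s)$. There is a constant $C>0$, depending only on $\beta$, $s$, $c_0$ and $C_0$, such that for all such $X$, $Y$, $A(\cdot,\cdot)$, all $t\ge0$ with $-t\le s$, all $f\in D(A^t)$ and all $k>0$ the following holds. For all integers $M,N>0$, $(A^{-\beta}-\mathcal Q_k^{-\beta}(A))f\in D(A^{s+t})$ and $$\|(A^{-\beta}-\mathcal Q_k^{-\beta}(A))f\|_{D(A^{s+t})}\le C\Big[\big(\sinh(\pi^2/(2k))\big)^{-1}e^{-\pi^2/(2k)}+e^{-(\beta-s^+)Nk}+e^{-(1-\beta)Mk}\Big]\|f\|_{D(A^t)} .$$ In particular, for the balanced choice $N=\big\lceil\frac{\pi^2}{2(\beta-s^+)k^2}\big\rceil$, $M=\big\lceil\frac{\pi^2}{2(1-\beta)k^2}\big\rceil$, $$\|(A^{-\beta}-\mathcal Q_k^{-\beta}(A))f\|_{D(A^{s+t})}\le C\Big[\frac1{\beta-s^+}+\frac1{1-\beta}\Big]\Big[\frac{e^{-\pi^2/(2k)}}{\sinh(\pi^2/(2k))}+e^{-\pi^2/(2k)}\Big]\|f\|_{D(A^t)}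 .$$ -/

import Mathlib

open MeasureTheory Set
open scoped InnerProductSpace

namespace SincQuadrature

/-- A regular (bounded and coercive) sesquilinear form on a complex Hilbert space `Y` that is
continuously and densely embedded in a complex Hilbert space `X`; `ι` is the embedding `Y ⊆ X`.
The form is linear in its first and conjugate-linear in its second argument.
`norm_le` is the normalisation `‖y‖_X ≤ ‖y‖_Y`. -/
structure RegularForm (X Y : Type*) [NormedAddCommGroup X] [InnerProductSpace ℂ X]
    [NormedAddCommGroup Y] [InnerProductSpace ℂ Y] (c₀ C₀ : ℝ) where
  ι : Y →L[ℂ] X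
  ι_injective : Function.Injective ι
  ι_denseRange : DenseRange ι
  norm_le : ∀ y : Y, ‖ι y‖ ≤ ‖y‖
  form : Y →ₗ[ℂ] Y →ₗ⋆[ℂ] ℂ
  c₀_pos : 0 < c₀
  coercive : ∀ v : Y, c₀ * ‖v‖ ^ 2 ≤ (form v v).re
  bounded : ∀ u v : Y, ‖form u v‖ ≤ C₀ * ‖u‖ * ‖v‖

section Calculus

variable {X : Type*} [NormedAddCommGroup X] [InnerProductSpace ℂ X]

open Classical in
/-- The resolvent `(z I + A)⁻¹` of an unbounded operator `A` on `X`, as a function on `X`: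
`(z I + A)⁻¹ f` is the `w ∈ D(A)` with `z w + A w = f` (and `0` if there is none). For the operator
of a regular form and `0 ≤ Re z`, there is exactly one such `w`, see
`RegularForm.existsUnique_resolvent`. -/
noncomputable def resolvent (A : X →ₗ.[ℂ] X) (z : ℂ) (f : X) : X :=
  if h : ∃ w : A.domain, z • (w : X) + A w = f then (h.choose : X) else 0

/-- The negative fractional power
`A^{-β} f = (sin (π β) / π) ∫_0^∞ μ^{-β} (μ I + A)⁻¹ f dμ`, for `β ∈ (0,1)`. For the operator of a
regular form the integral converges as a Bochner integral, see
`RegularForm.integrableOn_balakrishnan`. -/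
noncomputable def negPow (A : X →ₗ.[ℂ] X) (β : ℝ) (f : X) : X :=
  (Real.sin (Real.pi * β) / Real.pi) • ∫ μ in Ioi (0 : ℝ), (μ ^ (-β)) • resolvent A (μ : ℂ) f

/-- The truncated sinc quadrature
`(k sin (π β) / π) ∑_{ℓ=-M}^{N} e^{(1-β) y_ℓ} (e^{y_ℓ} I + A)⁻¹ f`, with `y_ℓ = ℓ k`. -/
noncomputable def sincQuad (A : X →ₗ.[ℂ] X) (β k : ℝ) (M N : ℕ) (f : X) : X :=
  (k * Real.sin (Real.pi * β) / Real.pi) •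
    ∑ l ∈ Finset.Icc (-(M : ℤ)) (N : ℤ),
      Real.exp ((1 - β) * (l * k)) • resolvent A (Real.exp (l * k) : ℂ) f

open Classical in
/-- `A` as a function on all of `X`, with value `0` outside `D(A)`. -/
noncomputable def extend (A : X →ₗ.[ℂ] X) (x : X) : X :=
  if h : x ∈ A.domain then A ⟨x, h⟩ else 0

/-- `D(Aⁿ)`: all of `x, A x, …, A^{n-1} x` are in `D(A)`. -/
def natDomain (A : X →ₗ.[ℂ] X) (n : ℕ) : Set X :=
  {x | ∀ j < n, (extend A)^[j] x ∈ A.domain}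

open Classical in
/-- `A^{r-n} x` for `n = ⌈r⌉` and `r ≥ 0`: it is `x` if `r` is an integer, and is given by the
Balakrishnan integral (with exponent `n - r ∈ (0,1)`) if not. -/
noncomputable def fracPart (A : X →ₗ.[ℂ] X) (r : ℝ) (x : X) : X :=
  if (⌈r⌉₊ : ℝ) = r then x else negPow A (⌈r⌉₊ - r) x

/-- `D(A^r) = {x : A^{r-n} x ∈ D(Aⁿ)}`, with `n = ⌈r⌉`, for `r ≥ 0`. -/
def fracDomain (A : X →ₗ.[ℂ] X) (r : ℝ) : Set X :=
  {x | fracPart A r x ∈ natDomain A ⌈r⌉₊}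

/-- `A^r x = Aⁿ A^{r-n} x`, with `n = ⌈r⌉`, for `r ≥ 0` and `x ∈ D(A^r)`. -/
noncomputable def fracPow (A : X →ₗ.[ℂ] X) (r : ℝ) (x : X) : X :=
  (extend A)^[⌈r⌉₊] (fracPart A r x)

/-- The norm `‖x‖_{D(A^r)} = ‖A^r x‖_X`, for `r ≥ 0` and `x ∈ D(A^r)`. -/
noncomputable def fracNorm (A : X →ₗ.[ℂ] X) (r : ℝ) (x : X) : ℝ :=
  ‖fracPow A r x‖

end Calculus

namespace RegularForm

variable {X Y : Type*} [NormedAddCommGroup X] [InnerProductSpace ℂ X]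
  [NormedAddCommGroup Y] [InnerProductSpace ℂ Y] {c₀ C₀ : ℝ}

/-- The graph of the operator of the form: the pairs `(ι u, f)` with `u ∈ Y`, `f ∈ X` and
`A(u, φ) = (f, φ)_X` for all `φ ∈ Y`, that is, the pairs `(T f, f)` for the solution operator `T`.
(Mathlib's inner product is conjugate-linear in its first argument: `(f, φ)_X = ⟪ι φ, f⟫`.) -/
def graph (F : RegularForm X Y c₀ C₀) : Submodule ℂ (X × X) where
  carrier := {p | ∃ u : Y, F.ι u = p.1 ∧ ∀ φ : Y, F.form u φ = ⟪F.ι φ, p.2⟫_ℂ}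
  zero_mem' := ⟨0, by simp⟩
  add_mem' := by
    rintro p q ⟨u, hu, hu'⟩ ⟨v, hv, hv'⟩
    exact ⟨u + v, by simp [hu, hv], fun φ => by simp [hu', hv']⟩
  smul_mem' := by
    rintro c p ⟨u, hu, hu'⟩
    exact ⟨c • u, by simp [hu], fun φ => by simp [hu']⟩

/-- The regularly accretive operator `A = T⁻¹` with domain `D(A) = Range T`, where `T` is the
solution operator of the form. -/
noncomputable def operator (F : RegularForm X Y c₀ C₀) : X →ₗ.[ℂ] X :=
  F.graph.toLinearPMap

theorem operator_graph (F : RegularForm X Y c₀ C₀) : F.operator.graph = F.graph := by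
  refine Submodule.toLinearPMap_graph_eq _ ?_
  rintro ⟨x, y⟩ ⟨u, hu, hu'⟩ hx
  simp only at hx hu hu'
  have : u = 0 := F.ι_injective (by rw [hu, hx, map_zero])
  subst this
  exact F.ι_denseRange.eq_zero_of_inner_right (𝕜 := ℂ) fun φ => by simpa using (hu' φ).symm

/-- The Lax-Milgram theorem for the form `A(u, φ) + z (u, φ)_X`, where `0 ≤ Re z`; for `z = 0` it
says that the solution operator `T` is well defined. -/
theorem existsUnique_laxMilgram [CompleteSpace X] [CompleteSpace Y]
    (F : RegularForm X Y c₀ C₀) {z : ℂ} (hz : 0 ≤ z.re) (f : X) :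
    ∃! u : Y, ∀ φ : Y, F.form u φ + z * ⟪F.ι φ, F.ι u⟫_ℂ = ⟪F.ι φ, f⟫_ℂ := by
  have hc := F.c₀_pos
  let B₀ : Y →ₗ⋆[ℂ] Y →ₗ[ℂ] ℂ := LinearMap.mk₂'ₛₗ (starRingEnd ℂ) (RingHom.id ℂ)
    (fun u φ => (starRingEnd ℂ) (F.form u φ + z * ⟪F.ι φ, F.ι u⟫_ℂ))
    (fun u v φ => by simp; ring)
    (fun c u φ => by simp; ring)
    (fun u v φ => by simp; ring)
    (fun c u φ => by simp; ring)
  have hB₀ : ∀ u φ, B₀ u φ = (starRingEnd ℂ) (F.form u φ + z * ⟪F.ι φ, F.ι u⟫_ℂ) :=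
    fun _ _ => rfl
  have hbd : ∀ u φ, ‖B₀ u φ‖ ≤ (C₀ + ‖z‖) * ‖u‖ * ‖φ‖ := by
    intro u φ
    rw [hB₀, RCLike.norm_conj]
    refine (norm_add_le _ _).trans ?_
    have h1 := F.bounded u φ
    have h2 : ‖z * ⟪F.ι φ, F.ι u⟫_ℂ‖ ≤ ‖z‖ * (‖φ‖ * ‖u‖) := by
      rw [norm_mul]
      have := norm_inner_le_norm (𝕜 := ℂ) (F.ι φ) (F.ι u)
      have h3 := F.norm_le φ
      have h4 := F.norm_le u
      gcongr
      exact this.trans (by gcongr)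
    linarith
  let B : Y →L⋆[ℂ] Y →L[ℂ] ℂ := B₀.mkContinuous₂ _ hbd
  let L : Y →L[ℂ] Y := InnerProductSpace.continuousLinearMapOfBilin B
  have hL : ∀ u φ, ⟪φ, L u⟫_ℂ = F.form u φ + z * ⟪F.ι φ, F.ι u⟫_ℂ := by
    intro u φ
    rw [← inner_conj_symm, InnerProductSpace.continuousLinearMapOfBilin_apply]
    change (starRingEnd ℂ) (B₀ u φ) = _
    rw [hB₀, Complex.conj_conj]
  have hco : ∀ u, c₀ * ‖u‖ ^ 2 ≤ (⟪u, L u⟫_ℂ).re := by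
    intro u
    rw [hL, inner_self_eq_norm_sq_to_K, Complex.add_re]
    have h1 := F.coercive u
    have h2 : 0 ≤ (z * ((‖F.ι u‖ : ℂ)) ^ 2).re := by
      rw [← Complex.ofReal_pow, Complex.re_mul_ofReal]
      positivity
    exact h1.trans (le_add_of_nonneg_right h2)
  have hlow : ∀ u, c₀ * ‖u‖ ≤ ‖L u‖ := by
    intro u
    rcases eq_or_ne u 0 with rfl | hu
    · simp
    · have hu' : 0 < ‖u‖ := norm_pos_iff.mpr hu
      have h1 : (⟪u, L u⟫_ℂ).re ≤ ‖u‖ * ‖L u‖ :=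
        (Complex.re_le_norm _).trans (norm_inner_le_norm _ _)
      have h2 := hco u
      nlinarith
  have hanti : AntilipschitzWith (c₀⁻¹).toNNReal L := by
    refine ContinuousLinearMap.antilipschitz_of_bound L fun u => ?_
    rw [Real.coe_toNNReal _ (by positivity), ← div_eq_inv_mul, le_div_iff₀ hc, mul_comm]
    exact hlow u
  have hrange : L.range = ⊤ := by
    have := (hanti.isClosed_range L.uniformContinuous).completeSpace_coe
    have : CompleteSpace L.range := this
    rw [← L.range.orthogonal_orthogonal, Submodule.eq_top_iff']
    intro v w hw
    have h0 : ⟪w, L w⟫_ℂ = 0 := by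
      rw [← inner_conj_symm, hw (L w) ⟨w, rfl⟩, map_zero]
    have h1 := hco w
    rw [h0, Complex.zero_re] at h1
    have h2 : ‖w‖ ^ 2 ≤ 0 := by nlinarith [sq_nonneg ‖w‖]
    have h3 : w = 0 := by
      rw [← norm_eq_zero]
      nlinarith [norm_nonneg w]
    rw [h3, inner_zero_left]
  have key : ∀ u, (∀ φ : Y, F.form u φ + z * ⟪F.ι φ, F.ι u⟫_ℂ = ⟪F.ι φ, f⟫_ℂ) ↔
      L u = F.ι.adjoint f := by
    intro u
    constructor
    · intro h
      refine ext_inner_left ℂ fun φ => ?_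
      rw [hL, h, ContinuousLinearMap.adjoint_inner_right]
    · intro h φ
      rw [← hL, h, ContinuousLinearMap.adjoint_inner_right]
  obtain ⟨u, hu⟩ : F.ι.adjoint f ∈ L.range := hrange ▸ Submodule.mem_top
  exact ⟨u, (key u).2 hu, fun v hv => hanti.injective (((key v).1 hv).trans hu.symm)⟩

/-- `(x, z x + A x)` runs through the solution pairs of the shifted form. -/
theorem operator_shift_iff (F : RegularForm X Y c₀ C₀) (z : ℂ) (x f : X) :
    (∃ w : F.operator.domain, (w : X) = x ∧ z • (w : X) + F.operator w = f) ↔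
      ∃ u : Y, F.ι u = x ∧ ∀ φ : Y, F.form u φ + z * ⟪F.ι φ, F.ι u⟫_ℂ = ⟪F.ι φ, f⟫_ℂ := by
  constructor
  · rintro ⟨w, rfl, rfl⟩
    have hw : ((w : X), F.operator w) ∈ F.graph := by
      rw [← operator_graph]
      exact F.operator.mem_graph w
    obtain ⟨u, hu, hu'⟩ := hw
    refine ⟨u, hu, fun φ => ?_⟩
    rw [hu', hu, inner_add_right, inner_smul_right, add_comm]
  · rintro ⟨u, rfl, hu⟩
    have hw : (F.ι u, f - z • F.ι u) ∈ F.operator.graph := by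
      rw [operator_graph]
      refine ⟨u, rfl, fun φ => ?_⟩
      rw [inner_sub_right, inner_smul_right, ← hu φ]
      ring
    obtain ⟨w, hw1, hw2⟩ := (LinearPMap.mem_graph_iff _).1 hw
    refine ⟨w, hw1, ?_⟩
    simp only at hw1 hw2
    rw [hw2, hw1]
    abel

/-- `z I + A` maps `D(A)` one-to-one onto `X` if `0 ≤ Re z`. -/
theorem existsUnique_resolvent [CompleteSpace X] [CompleteSpace Y]
    (F : RegularForm X Y c₀ C₀) {z : ℂ} (hz : 0 ≤ z.re) (f : X) :
    ∃! w : F.operator.domain, z • (w : X) + F.operator w = f := by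
  obtain ⟨u, hu, huniq⟩ := F.existsUnique_laxMilgram hz f
  obtain ⟨w, hw, hw'⟩ := (F.operator_shift_iff z (F.ι u) f).2 ⟨u, rfl, hu⟩
  refine ⟨w, hw', fun w' h' => ?_⟩
  obtain ⟨v, hv, hv'⟩ := (F.operator_shift_iff z (w' : X) f).1 ⟨w', rfl, h'⟩
  ext
  rw [← hv, hw, huniq v hv']

/-- The Balakrishnan integral converges absolutely. -/
theorem integrableOn_balakrishnan [CompleteSpace X] [CompleteSpace Y]
    (F : RegularForm X Y c₀ C₀) {β : ℝ} (hβ : β ∈ Ioo (0 : ℝ) 1) (f : X) :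
    IntegrableOn (fun μ : ℝ => (μ ^ (-β)) • resolvent F.operator (μ : ℂ) f) (Ioi 0) := by
  have hc := F.c₀_pos
  have hR : ∀ μ : ℝ, 0 ≤ μ → ∃ u : Y, F.ι u = resolvent F.operator (μ : ℂ) f ∧
      ∀ φ : Y, F.form u φ + μ * ⟪F.ι φ, F.ι u⟫_ℂ = ⟪F.ι φ, f⟫_ℂ := by
    intro μ hμ
    have h := (F.existsUnique_resolvent (z := (μ : ℂ)) (by simpa using hμ) f).exists
    refine (F.operator_shift_iff μ _ f).1 ⟨h.choose, ?_, h.choose_spec⟩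
    rw [resolvent, dif_pos h]
  have hest : ∀ (μ : ℝ) (u : Y) (g : X), 0 ≤ μ →
      (∀ φ : Y, F.form u φ + μ * ⟪F.ι φ, F.ι u⟫_ℂ = ⟪F.ι φ, g⟫_ℂ) →
      c₀ * ‖F.ι u‖ ≤ ‖g‖ ∧ μ * ‖F.ι u‖ ≤ ‖g‖ := by
    intro μ u g hμ hu
    have h1 := congrArg Complex.re (hu u)
    rw [inner_self_eq_norm_sq_to_K, Complex.add_re] at h1
    have h2 : ((μ : ℂ) * ((‖F.ι u‖ : ℂ)) ^ 2).re = μ * ‖F.ι u‖ ^ 2 := by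
      rw [← Complex.ofReal_pow, ← Complex.ofReal_mul, Complex.ofReal_re]
    have h3 := F.coercive u
    have h4 : (⟪F.ι u, g⟫_ℂ).re ≤ ‖F.ι u‖ * ‖g‖ :=
      (Complex.re_le_norm _).trans (norm_inner_le_norm _ _)
    have h5 : ‖F.ι u‖ ^ 2 ≤ ‖u‖ ^ 2 := by
      have := F.norm_le u
      gcongr
    have h1' : (F.form u u).re + μ * ‖F.ι u‖ ^ 2 = (⟪F.ι u, g⟫_ℂ).re := by
      rw [← h2]; exact h1
    have h6 : 0 ≤ μ * ‖F.ι u‖ ^ 2 := by positivity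
    have h7 : c₀ * ‖F.ι u‖ ^ 2 ≤ c₀ * ‖u‖ ^ 2 := by gcongr
    rcases eq_or_lt_of_le (norm_nonneg (F.ι u)) with h0 | h0
    · rw [← h0]; simp
    · have h8 : 0 ≤ c₀ * ‖F.ι u‖ ^ 2 := by positivity
      constructor <;> nlinarith
  have hbd : ∀ μ : ℝ, 0 < μ → c₀ * ‖resolvent F.operator (μ : ℂ) f‖ ≤ ‖f‖ ∧
      μ * ‖resolvent F.operator (μ : ℂ) f‖ ≤ ‖f‖ := by
    intro μ hμ
    obtain ⟨u, hu, hu'⟩ := hR μ hμ.le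
    rw [← hu]
    exact hest μ u f hμ.le hu'
  have hlip : ∀ μ : ℝ, 0 < μ → ∀ ν : ℝ, 0 < ν →
      ‖resolvent F.operator (μ : ℂ) f - resolvent F.operator (ν : ℂ) f‖ ≤
        (‖f‖ / c₀ / c₀) * ‖μ - ν‖ := by
    intro μ hμ ν hν
    obtain ⟨u, hu, hu'⟩ := hR μ hμ.le
    obtain ⟨v, hv, hv'⟩ := hR ν hν.le
    have h1 := (hest μ (u - v) (((ν - μ : ℝ) : ℂ) • F.ι v) hμ.le (fun φ => by
      have e1 := hu' φ
      have e2 := hv' φ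
      rw [map_sub, map_sub, LinearMap.sub_apply, inner_sub_right, inner_smul_right]
      push_cast
      linear_combination e1 - e2)).1
    have h2 := (hbd ν hν).1
    rw [norm_smul, map_sub, hu, hv, Complex.norm_real, norm_sub_rev ν μ] at h1
    rw [div_div, div_mul_eq_mul_div, le_div_iff₀ (by positivity)]
    have h3 : ‖μ - ν‖ * (c₀ * ‖resolvent F.operator (ν : ℂ) f‖) ≤ ‖μ - ν‖ * ‖f‖ := by gcongr
    nlinarith
  have hcont : ContinuousOn (fun μ : ℝ => resolvent F.operator (μ : ℂ) f) (Ioi 0) := by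
    have : LipschitzOnWith (‖f‖ / c₀ / c₀).toNNReal
        (fun μ : ℝ => resolvent F.operator (μ : ℂ) f) (Ioi 0) := by
      refine LipschitzOnWith.of_dist_le_mul fun μ hμ ν hν => ?_
      rw [Real.coe_toNNReal _ (by positivity), dist_eq_norm, dist_eq_norm]
      exact hlip μ hμ ν hν
    exact this.continuousOn
  have hcont' : ContinuousOn
      (fun μ : ℝ => (μ ^ (-β)) • resolvent F.operator (μ : ℂ) f) (Ioi 0) :=
    (continuousOn_id.rpow_const fun x hx => Or.inl (ne_of_gt hx)).smul hcont
  have hmeas := hcont'.aestronglyMeasurable (μ := volume) measurableSet_Ioi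
  have hpos : ∀ μ : ℝ, 0 < μ → ‖(μ ^ (-β)) • resolvent F.operator (μ : ℂ) f‖
      = μ ^ (-β) * ‖resolvent F.operator (μ : ℂ) f‖ := by
    intro μ hμ
    rw [norm_smul, Real.norm_of_nonneg (Real.rpow_nonneg hμ.le _)]
  rw [← Ioc_union_Ioi_eq_Ioi (zero_le_one (α := ℝ)), integrableOn_union]
  constructor
  · have hi : IntegrableOn (fun μ : ℝ => μ ^ (-β) * (‖f‖ / c₀)) (Ioc 0 1) := by
      refine Integrable.mul_const ?_ _
      have := (intervalIntegral.intervalIntegrable_rpow' (a := 0) (b := 1) (r := -β)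
        (by linarith [hβ.2])).1
      exact this
    refine Integrable.mono' hi (hmeas.mono_set Ioc_subset_Ioi_self) ?_
    refine (ae_restrict_iff' measurableSet_Ioc).2 (Filter.Eventually.of_forall fun μ hμ => ?_)
    rw [hpos μ hμ.1]
    have h0 := Real.rpow_nonneg hμ.1.le (-β)
    have h1 := (hbd μ hμ.1).1
    gcongr
    rw [le_div_iff₀ hc, mul_comm]
    exact h1
  · have hi : IntegrableOn (fun μ : ℝ => μ ^ (-β - 1) * ‖f‖) (Ioi 1) :=
      Integrable.mul_const (integrableOn_Ioi_rpow_of_lt (by linarith [hβ.1]) one_pos) _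
    refine Integrable.mono' hi
      (hmeas.mono_set (Ioi_subset_Ioi zero_le_one)) ?_
    refine (ae_restrict_iff' measurableSet_Ioi).2 (Filter.Eventually.of_forall fun μ hμ => ?_)
    have hμ0 : 0 < μ := lt_trans one_pos hμ
    rw [hpos μ hμ0, Real.rpow_sub_one hμ0.ne', div_mul_eq_mul_div, mul_div_assoc]
    have h0 := Real.rpow_nonneg hμ0.le (-β)
    have h1 := (hbd μ hμ0).2
    gcongr
    rw [le_div_iff₀ hμ0, mul_comm]
    exact h1

end RegularForm

end SincQuadrature

/-! The error operator `E = A^{-β} - Q` of the quadrature commutes with the powers of `A`, so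
everything reduces to a bound for the operator `H = A^s E`, first for `0 ≤ s < β`. By the
substitution `μ = e^y` the Balakrishnan integral for `A^s A^{-β}` becomes the integral over `ℝ` of
`e^{(1-β)y} A^s (e^y + A)⁻¹`, and the quadrature is its truncated trapezoidal rule of step `k`.

For `|Im y| ≤ π / 2` the point `e^y` lies in the closed right half plane, where sectoriality gives
`|z| ‖(z + A)⁻¹‖ ≤ 1 + |C₀| / c₀` (`RegularForm.norm_solution_le`). From this follows
`‖A^s (z + A)⁻¹‖ ≤ C min 1 (|z|^{s-1})` (`RegularForm.norm_smoothed_le`). So the integrand extends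
holomorphically to the strip of half width `π / 2` and decays there like `e^{(1-β) Re y}` on the
left and `e^{-(β-s) Re y}` on the right. For such functions the error of the full trapezoidal rule
is, by Poisson summation, the sum of the Fourier transform over the nonzero points of the dual
lattice; moving the contour to the edge of the strip bounds it by
`e^{-π²/(2k)} / sinh (π²/(2k))`. The two geometric tails give the truncation errors
(`IsStripDecaying.norm_integral_sub_sum_le`).

To use this in the norms of `D(A^r)`, the powers `A^{-r}` must form a semigroup
(`RegularForm.negPower_add`); then `D(A^r)` is the range of `A^{-r}`, and `A^r A^{-r} g = g`. In
the product of two Balakrishnan integrals the substitution `λ = r μ` produces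
`(r μ + A)⁻¹ (μ + A)⁻¹`, and the resolvent identity evaluates the inner integral for each `r ≠ 1`.
The product is thus a universal scalar times the expected power
(`IsResolventFamily.stieltjes_mul_stieltjes_of_inner`). The scalar is found by taking `A = 1` on
`ℝ`, where the Balakrishnan formula is the reflection formula for the Gamma function.

For `f = A^{-t} g` and `s⁺ = max 0 s`, `s⁻ = max 0 (-s)` this gives
`E f = A^{-(s+t)} (A^{-s⁻} H g)` with `A^{-s⁺} H = E`, which is the claim. -/

namespace SincQuadrature

/-! ### Balakrishnan integrals: convergence and normalisation -/

/-- The interpolation bound behind all estimates for fractional powers: a function bounded by both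
`K / a` and `K / μ` has a `μ^{-β}`-weighted integral of size `K a^{-β}`. The integral is split at
`μ = a`. -/
theorem integrableOn_rpow_smul_and_norm_integral_le {E : Type*} [NormedAddCommGroup E]
    [NormedSpace ℝ E] {Φ : ℝ → E} (hΦ : ContinuousOn Φ (Ioi 0)) {K a β : ℝ} (ha : 0 < a)
    (hβ : β ∈ Ioo (0 : ℝ) 1) (h₁ : ∀ μ > 0, ‖Φ μ‖ ≤ K / a) (h₂ : ∀ μ > 0, ‖Φ μ‖ ≤ K / μ) :
    IntegrableOn (fun μ : ℝ => μ ^ (-β) • Φ μ) (Ioi 0) ∧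
      ‖∫ μ in Ioi (0 : ℝ), μ ^ (-β) • Φ μ‖ ≤ K * a ^ (-β) * (1 / (1 - β) + 1 / β) := by
  have hmeas : AEStronglyMeasurable (fun μ : ℝ => μ ^ (-β) • Φ μ) (volume.restrict (Ioi 0)) :=
    ((continuousOn_id.rpow_const fun x hx => Or.inl (ne_of_gt hx)).smul hΦ).aestronglyMeasurable
      measurableSet_Ioi
  have hn : ∀ μ : ℝ, 0 < μ → ‖μ ^ (-β) • Φ μ‖ = μ ^ (-β) * ‖Φ μ‖ := fun μ hμ => by
    rw [norm_smul, Real.norm_of_nonneg (Real.rpow_nonneg hμ.le _)]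
  have i₁ : IntegrableOn (fun μ : ℝ => μ ^ (-β) * (K / a)) (Ioc 0 a) :=
    Integrable.mul_const (intervalIntegral.intervalIntegrable_rpow' (a := 0) (b := a) (r := -β)
        (by linarith [hβ.2])).1 _
  have i₂ : IntegrableOn (fun μ : ℝ => μ ^ (-β - 1) * K) (Ioi a) :=
    Integrable.mul_const (integrableOn_Ioi_rpow_of_lt (by linarith [hβ.1]) ha) _
  have b₁ : ∀ᵐ μ ∂volume.restrict (Ioc 0 a), ‖μ ^ (-β) • Φ μ‖ ≤ μ ^ (-β) * (K / a) := by
    refine (ae_restrict_iff' measurableSet_Ioc).2 (Filter.Eventually.of_forall fun μ hμ => ?_)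
    rw [hn μ hμ.1]
    exact mul_le_mul_of_nonneg_left (h₁ μ hμ.1) (Real.rpow_nonneg hμ.1.le _)
  have b₂ : ∀ᵐ μ ∂volume.restrict (Ioi a), ‖μ ^ (-β) • Φ μ‖ ≤ μ ^ (-β - 1) * K := by
    refine (ae_restrict_iff' measurableSet_Ioi).2 (Filter.Eventually.of_forall fun μ hμ => ?_)
    have hμ0 : 0 < μ := ha.trans hμ
    rw [hn μ hμ0, Real.rpow_sub_one hμ0.ne', div_mul_eq_mul_div, mul_div_assoc]
    exact mul_le_mul_of_nonneg_left (h₂ μ hμ0) (Real.rpow_nonneg hμ0.le _)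
  have f₁ : IntegrableOn (fun μ : ℝ => μ ^ (-β) • Φ μ) (Ioc 0 a) :=
    Integrable.mono' i₁ (hmeas.mono_set Ioc_subset_Ioi_self) b₁
  have f₂ : IntegrableOn (fun μ : ℝ => μ ^ (-β) • Φ μ) (Ioi a) :=
    Integrable.mono' i₂ (hmeas.mono_set (Ioi_subset_Ioi ha.le)) b₂
  rw [← Ioc_union_Ioi_eq_Ioi ha.le]
  refine ⟨f₁.union f₂, ?_⟩
  rw [setIntegral_union (Ioc_disjoint_Ioi le_rfl) measurableSet_Ioi f₁ f₂]
  refine (norm_add_le _ _).trans ?_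
  have e₁ := norm_integral_le_of_norm_le i₁ b₁
  have e₂ := norm_integral_le_of_norm_le i₂ b₂
  have e₀ : ∫ μ in Ioc 0 a, μ ^ (-β) = a ^ (-β + 1) / (-β + 1) := by
    rw [← intervalIntegral.integral_of_le ha.le, integral_rpow (Or.inl (by linarith [hβ.2])),
      Real.zero_rpow (by linarith [hβ.2]), sub_zero]
  rw [integral_mul_const, e₀] at e₁
  rw [integral_mul_const, integral_Ioi_rpow_of_lt (by linarith [hβ.1]) ha] at e₂
  have hβ0 := hβ.1
  have hβ1 : 0 < 1 - β := by linarith [hβ.2]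
  refine (add_le_add e₁ e₂).trans (le_of_eq ?_)
  rw [Real.rpow_add_one ha.ne', sub_add_cancel, neg_add_eq_sub]
  field_simp

/-- The normalising factor `sin (π β) / π` of the Balakrishnan integral. -/
noncomputable def balakrishnanConst (β : ℝ) : ℝ := Real.sin (Real.pi * β) / Real.pi

theorem balakrishnanConst_pos {β : ℝ} (hβ : β ∈ Ioo (0 : ℝ) 1) : 0 < balakrishnanConst β :=
  div_pos (Real.sin_pos_of_pos_of_lt_pi (mul_pos Real.pi_pos hβ.1)
    (by nlinarith [hβ.2, Real.pi_pos])) Real.pi_pos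

/-- The scalar case `A = 1` of the Balakrishnan formula. -/
theorem integral_rpow_div_one_add {β : ℝ} (hβ : β ∈ Ioo (0 : ℝ) 1) :
    ∫ μ in Ioi (0 : ℝ), μ ^ (-β) * (1 + μ)⁻¹ = (balakrishnanConst β)⁻¹ := by
  have h0 := hβ.1
  have h1 : 0 < 1 - β := by linarith [hβ.2]
  have hB : Complex.betaIntegral ((1 - β : ℝ) : ℂ) (β : ℝ) = ((balakrishnanConst β)⁻¹ : ℝ) := by
    rw [Complex.betaIntegral_eq_Gamma_mul_div _ _ (by simpa using h1) (by simpa using h0),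
      ← Complex.ofReal_add, sub_add_cancel, Complex.ofReal_one, Complex.Gamma_one, div_one,
      Complex.Gamma_ofReal, Complex.Gamma_ofReal, ← Complex.ofReal_mul, mul_comm,
      Real.Gamma_mul_Gamma_one_sub, balakrishnanConst, inv_div]
  -- the substitution `x = μ / (1 + μ)` turns the integral into `B(1 - β, β) = Γ(1 - β) Γ(β)`
  have himg : (fun μ : ℝ => μ / (1 + μ)) '' Ioi 0 = Ioo 0 1 := by
    ext x
    constructor
    · rintro ⟨μ, hμ, rfl⟩
      have hμ' : (0 : ℝ) < μ := hμ
      exact ⟨by positivity, (div_lt_one (by positivity)).2 (by linarith)⟩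
    · rintro ⟨hx0, hx1⟩
      have hx2 : 0 < 1 - x := by linarith
      refine ⟨x / (1 - x), div_pos hx0 hx2, ?_⟩
      simp only
      field_simp
      ring
  have hsub := integral_image_eq_integral_abs_deriv_smul (F := ℝ) (s := Ioi (0 : ℝ))
    (f := fun μ : ℝ => μ / (1 + μ)) (f' := fun μ : ℝ => ((1 + μ) ^ 2)⁻¹) measurableSet_Ioi
    (fun μ hμ => by
      have hμ' : (0 : ℝ) < μ := hμ
      have h := (hasDerivAt_id' μ).div ((hasDerivAt_id' μ).const_add 1)
        (by positivity : (1 + μ) ≠ 0)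
      have e : (1 * (1 + μ) - μ * 1) / (1 + μ) ^ 2 = ((1 + μ) ^ 2)⁻¹ := by
        rw [inv_eq_one_div]
        congr 1
        ring
      rw [e] at h
      exact h.hasDerivWithinAt)
    (fun μ hμ ν hν h => by
      have hμ' : (0 : ℝ) < μ := hμ
      have hν' : (0 : ℝ) < ν := hν
      simp only at h
      rw [div_eq_div_iff (by positivity) (by positivity)] at h
      linarith)
    (fun x => x ^ (-β) * (1 - x) ^ (β - 1))
  rw [himg] at hsub
  have hlhs : ∫ x in Ioo (0 : ℝ) 1, x ^ (-β) * (1 - x) ^ (β - 1) = (balakrishnanConst β)⁻¹ := by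
    have : (((∫ x in Ioo (0 : ℝ) 1, x ^ (-β) * (1 - x) ^ (β - 1)) : ℝ) : ℂ)
        = ((balakrishnanConst β)⁻¹ : ℝ) := by
      rw [← hB, Complex.betaIntegral, intervalIntegral.integral_of_le zero_le_one,
        integral_Ioc_eq_integral_Ioo, ← integral_complex_ofReal]
      refine setIntegral_congr_fun measurableSet_Ioo fun x hx => ?_
      rw [Complex.ofReal_mul, Complex.ofReal_cpow hx.1.le, Complex.ofReal_cpow (by linarith [hx.2])]
      push_cast
      congr 2
      ring
    exact_mod_cast this
  rw [← hlhs, hsub]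
  refine setIntegral_congr_fun measurableSet_Ioi fun μ hμ => ?_
  have hμ' : (0 : ℝ) < μ := hμ
  have h1μ : 0 < 1 + μ := by positivity
  have e : 1 - μ / (1 + μ) = (1 + μ)⁻¹ := by field_simp; ring
  simp only [smul_eq_mul]
  rw [e, abs_of_pos (by positivity), Real.div_rpow hμ'.le h1μ.le, Real.inv_rpow h1μ.le,
    Real.rpow_neg h1μ.le, Real.rpow_sub_one h1μ.ne']
  have : 0 < (1 + μ) ^ β := Real.rpow_pos_of_pos h1μ _
  field_simp

theorem integral_Ioi_eq_integral_exp_smul {E : Type*} [NormedAddCommGroup E] [NormedSpace ℝ E]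
    (g : ℝ → E) : ∫ μ in Ioi (0 : ℝ), g μ = ∫ x : ℝ, Real.exp x • g (Real.exp x) := by
  have h := integral_image_eq_integral_abs_deriv_smul MeasurableSet.univ
    (fun x _ => (Real.hasDerivAt_exp x).hasDerivWithinAt) Real.exp_injective.injOn g
  simpa [image_univ, Real.range_exp, abs_of_pos (Real.exp_pos _)] using h

theorem balakrishnanConst_le_one (β : ℝ) : balakrishnanConst β ≤ 1 := by
  refine (div_le_one Real.pi_pos).2 ((Real.sin_le_one _).trans ?_)
  linarith [Real.two_le_pi]

theorem norm_balakrishnanConst_smul_le {E : Type*} [NormedAddCommGroup E] [NormedSpace ℝ E] {β : ℝ}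
    (hβ : β ∈ Ioo (0 : ℝ) 1) (x : E) : ‖balakrishnanConst β • x‖ ≤ ‖x‖ := by
  rw [norm_smul, Real.norm_of_nonneg (balakrishnanConst_pos hβ).le]
  exact mul_le_of_le_one_left (norm_nonneg _) (balakrishnanConst_le_one β)

/-! ### The semigroup law for Balakrishnan integrals in a Banach algebra -/

section BanachAlgebra

variable {𝒜 : Type*} [NormedRing 𝒜] [NormedAlgebra ℝ 𝒜]

/-- A family `R μ`, `μ ≥ 0`, in a Banach algebra that behaves like the resolvents `(μ + A)⁻¹` of
an invertible operator of positive type: it satisfies the resolvent identity, and both `R μ` and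
`μ R μ` are bounded. -/
structure IsResolventFamily (R : ℝ → 𝒜) : Prop where
  bounded : ∃ K, ∀ μ, 0 ≤ μ → ‖R μ‖ ≤ K ∧ μ * ‖R μ‖ ≤ K
  sub_eq : ∀ μ ν, 0 ≤ μ → 0 ≤ ν → R μ - R ν = (ν - μ) • (R μ * R ν)

/-- The Balakrishnan integral without its normalising factor. -/
noncomputable def stieltjes (R : ℝ → 𝒜) (β : ℝ) : 𝒜 :=
  ∫ μ in Ioi (0 : ℝ), μ ^ (-β) • R μ

/-- The negative fractional power `A^{-β}`, `0 < β < 1`, in terms of the resolvents of `A`. -/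
noncomputable def balakrishnan (R : ℝ → 𝒜) (β : ℝ) : 𝒜 :=
  balakrishnanConst β • stieltjes R β

theorem isResolventFamily_inv_one_add : IsResolventFamily fun μ : ℝ => (1 + μ)⁻¹ where
  bounded := ⟨1, fun μ hμ => by
    have h : 0 < 1 + μ := by positivity
    rw [Real.norm_of_nonneg (by positivity), ← div_eq_mul_inv]
    exact ⟨inv_le_one_of_one_le₀ (by linarith), (div_le_one h).2 (by linarith)⟩⟩
  sub_eq μ ν hμ hν := by
    have h : 0 < 1 + μ := by positivity
    have h' : 0 < 1 + ν := by positivity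
    simp only [smul_eq_mul]
    field_simp
    ring

theorem stieltjes_inv_one_add {β : ℝ} (hβ : β ∈ Ioo (0 : ℝ) 1) :
    stieltjes (fun μ : ℝ => (1 + μ)⁻¹) β = (balakrishnanConst β)⁻¹ :=
  integral_rpow_div_one_add hβ

namespace IsResolventFamily

variable {R : ℝ → 𝒜}

theorem continuousOn (hR : IsResolventFamily R) : ContinuousOn R (Ici 0) := by
  obtain ⟨K, hK⟩ := hR.bounded
  have hK0 : 0 ≤ K := (norm_nonneg _).trans (hK 0 le_rfl).1
  have : LipschitzOnWith (K * K).toNNReal R (Ici 0) := by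
    refine LipschitzOnWith.of_dist_le_mul fun μ hμ ν hν => ?_
    rw [Real.coe_toNNReal _ (by positivity), dist_eq_norm, dist_eq_norm, hR.sub_eq μ ν hμ hν,
      norm_smul, norm_sub_rev, mul_comm]
    gcongr
    exact (norm_mul_le _ _).trans
      (mul_le_mul (hK μ hμ).1 (hK ν hν).1 (norm_nonneg _) hK0)
  exact this.continuousOn

theorem integrableOn (hR : IsResolventFamily R) {β : ℝ} (hβ : β ∈ Ioo (0 : ℝ) 1) :
    IntegrableOn (fun μ : ℝ => μ ^ (-β) • R μ) (Ioi 0) := by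
  obtain ⟨K, hK⟩ := hR.bounded
  refine (integrableOn_rpow_smul_and_norm_integral_le (K := K)
    (hR.continuousOn.mono Ioi_subset_Ici_self) one_pos hβ (fun μ hμ => ?_) fun μ hμ => ?_).1
  · simpa using (hK μ (le_of_lt hμ)).1
  · rw [le_div_iff₀ hμ, mul_comm]
    exact (hK μ (le_of_lt hμ)).2

theorem commute_stieltjes (hR : IsResolventFamily R) {β : ℝ} (hβ : β ∈ Ioo (0 : ℝ) 1) {x : 𝒜}
    (hx : ∀ μ, 0 < μ → Commute x (R μ)) : Commute x (stieltjes R β) := by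
  have hi := hR.integrableOn hβ
  rw [Commute, SemiconjBy, stieltjes, ← integral_const_mul_of_integrable hi,
    ← integral_mul_const_of_integrable hi]
  refine setIntegral_congr_fun measurableSet_Ioi fun μ hμ => ?_
  simp only [mul_smul_comm, smul_mul_assoc, (hx μ hμ).eq]

theorem commute_balakrishnan (hR : IsResolventFamily R) {β : ℝ} (hβ : β ∈ Ioo (0 : ℝ) 1) {x : 𝒜}
    (hx : ∀ μ, 0 < μ → Commute x (R μ)) : Commute x (balakrishnan R β) :=
  (hR.commute_stieltjes hβ hx).smul_right _

/-- The substitution `λ = r μ` turns a product of two Balakrishnan integrals into an iterated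
integral whose inner integral contains `R (r μ) * R μ`. By the resolvent identity the inner
integral is, for almost every `r`, a scalar `w r` times a fixed element `L`; then so is the
product. -/
theorem stieltjes_mul_stieltjes_of_inner [CompleteSpace 𝒜] (hR : IsResolventFamily R) {α β : ℝ}
    (hα : α ∈ Ioo (0 : ℝ) 1) (hβ : β ∈ Ioo (0 : ℝ) 1) (w : ℝ → ℝ) (L : 𝒜)
    (hw : ∀ r : ℝ, 0 < r → r ≠ 1 →
      IntegrableOn (fun μ : ℝ => μ ^ (1 - (α + β)) • (R (r * μ) * R μ)) (Ioi 0) →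
      ∫ μ in Ioi (0 : ℝ), μ ^ (1 - (α + β)) • (R (r * μ) * R μ) = w r • L) :
    stieltjes R α * stieltjes R β = (∫ r in Ioi (0 : ℝ), r ^ (-α) * w r) • L := by
  have iα := hR.integrableOn hα
  have iβ := hR.integrableOn hβ
  set Ψ : ℝ → ℝ → 𝒜 := fun μ r => (r ^ (-α) * μ ^ (1 - (α + β))) • (R (r * μ) * R μ) with hΨ
  have hpow : ∀ μ r : ℝ, 0 < μ → 0 < r →
      μ * ((r * μ) ^ (-α) * μ ^ (-β)) = r ^ (-α) * μ ^ (1 - (α + β)) := by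
    intro μ r hμ hr
    rw [Real.mul_rpow hr.le hμ.le, sub_eq_add_neg, Real.rpow_add hμ, Real.rpow_one, neg_add,
      Real.rpow_add hμ]
    ring
  have hmeas : AEStronglyMeasurable (Function.uncurry Ψ)
      ((volume.restrict (Ioi (0 : ℝ))).prod (volume.restrict (Ioi (0 : ℝ)))) := by
    rw [Measure.prod_restrict]
    refine ContinuousOn.aestronglyMeasurable ?_ (measurableSet_Ioi.prod measurableSet_Ioi)
    refine ContinuousOn.smul (ContinuousOn.mul ?_ ?_) (ContinuousOn.mul ?_ ?_)
    · exact continuousOn_snd.rpow_const fun p hp => Or.inl (ne_of_gt hp.2)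
    · exact continuousOn_fst.rpow_const fun p hp => Or.inl (ne_of_gt hp.1)
    · exact hR.continuousOn.comp (continuousOn_snd.mul continuousOn_fst)
        fun p hp => (mul_pos (show 0 < p.2 from hp.2) (show 0 < p.1 from hp.1)).le
    · exact hR.continuousOn.comp continuousOn_fst fun p hp => (show 0 < p.1 from hp.1).le
  have hscale : ∀ μ : ℝ, 0 < μ →
      IntegrableOn (fun r : ℝ => (r * μ) ^ (-α) • R (r * μ)) (Ioi 0) := by
    intro μ hμ
    simpa [mul_comm] using
      (integrableOn_Ioi_comp_mul_left_iff (fun l : ℝ => l ^ (-α) • R l) 0 hμ).2 (by simpa using iα)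
  have hΨ' : ∀ μ r : ℝ, 0 < μ → 0 < r →
      Ψ μ r = μ • (((r * μ) ^ (-α) • R (r * μ)) * (μ ^ (-β) • R μ)) := by
    intro μ r hμ hr
    simp only [hΨ]
    rw [← hpow μ r hμ hr, smul_mul_smul_comm, smul_smul]
  have hint : Integrable (Function.uncurry Ψ)
      ((volume.restrict (Ioi (0 : ℝ))).prod (volume.restrict (Ioi (0 : ℝ)))) := by
    rw [integrable_prod_iff hmeas]
    constructor
    · refine (ae_restrict_iff' measurableSet_Ioi).2 (Filter.Eventually.of_forall fun μ hμ => ?_)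
      have h1 : IntegrableOn (fun r : ℝ => μ • (((r * μ) ^ (-α) • R (r * μ)) * (μ ^ (-β) • R μ)))
          (Ioi 0) := ((hscale μ hμ).mul_const _).smul μ
      exact h1.congr_fun (fun r hr => (hΨ' μ r hμ hr).symm) measurableSet_Ioi
    · refine Integrable.mono' (iβ.norm.const_mul (∫ l in Ioi (0 : ℝ), ‖l ^ (-α) • R l‖))
        hmeas.norm.integral_prod_right' ?_
      refine (ae_restrict_iff' measurableSet_Ioi).2 (Filter.Eventually.of_forall fun μ hμ => ?_)
      have hμ' : (0 : ℝ) < μ := hμ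
      rw [Real.norm_of_nonneg (integral_nonneg fun _ => norm_nonneg _)]
      have h2 : ∫ r in Ioi (0 : ℝ), ‖(r * μ) ^ (-α) • R (r * μ)‖
          = μ⁻¹ * ∫ l in Ioi (0 : ℝ), ‖l ^ (-α) • R l‖ := by
        have := integral_comp_mul_right_Ioi (fun l : ℝ => ‖l ^ (-α) • R l‖) 0 hμ'
        simpa using this
      calc ∫ r in Ioi (0 : ℝ), ‖Ψ μ r‖
          ≤ ∫ r in Ioi (0 : ℝ), ‖(r * μ) ^ (-α) • R (r * μ)‖ * (μ * ‖μ ^ (-β) • R μ‖) := by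
            refine integral_mono_of_nonneg (Filter.Eventually.of_forall fun _ => norm_nonneg _)
              ((hscale μ hμ).norm.mul_const _) ?_
            refine (ae_restrict_iff' measurableSet_Ioi).2
              (Filter.Eventually.of_forall fun r hr => ?_)
            simp only
            rw [hΨ' μ r hμ hr, norm_smul, Real.norm_of_nonneg hμ'.le]
            have := mul_le_mul_of_nonneg_left
              (norm_mul_le ((r * μ) ^ (-α) • R (r * μ)) (μ ^ (-β) • R μ)) hμ'.le
            linarith
        _ = (∫ l in Ioi (0 : ℝ), ‖l ^ (-α) • R l‖) * ‖μ ^ (-β) • R μ‖ := by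
            rw [integral_mul_const, h2]
            field_simp
  calc stieltjes R α * stieltjes R β
      = ∫ μ in Ioi (0 : ℝ), ∫ r in Ioi (0 : ℝ), Ψ μ r := by
        conv_lhs => rw [stieltjes.eq_def R β]
        rw [← integral_const_mul_of_integrable iβ]
        refine setIntegral_congr_fun measurableSet_Ioi fun μ hμ => ?_
        have hμ' : (0 : ℝ) < μ := hμ
        have h1 : ∫ r in Ioi (0 : ℝ), Ψ μ r
            = ∫ r in Ioi (0 : ℝ), μ • (((r * μ) ^ (-α) • R (r * μ)) * (μ ^ (-β) • R μ)) :=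
          setIntegral_congr_fun measurableSet_Ioi fun r hr => hΨ' μ r hμ hr
        rw [h1, integral_smul, integral_mul_const_of_integrable (hscale μ hμ),
          ← smul_mul_assoc]
        have := integral_comp_mul_right_Ioi' (fun l : ℝ => l ^ (-α) • R l) 0 hμ'
        rw [this, zero_mul, stieltjes]
    _ = ∫ r in Ioi (0 : ℝ), ∫ μ in Ioi (0 : ℝ), Ψ μ r := integral_integral_swap hint
    _ = ∫ r in Ioi (0 : ℝ), (r ^ (-α) * w r) • L := by
        refine integral_congr_ae ?_
        have hne : ∀ᵐ r : ℝ ∂volume.restrict (Ioi 0), r ≠ 1 :=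
          ae_restrict_of_ae (by simp [ae_iff])
        filter_upwards [hne, hint.prod_left_ae, ae_restrict_mem measurableSet_Ioi] with r h1 h2 h3
        have hr : (0 : ℝ) < r := h3
        have hr' : r ^ (-α) ≠ 0 := (Real.rpow_pos_of_pos hr _).ne'
        have e : ∀ μ, Ψ μ r = r ^ (-α) • (μ ^ (1 - (α + β)) • (R (r * μ) * R μ)) :=
          fun μ => by simp only [hΨ, smul_smul]
        simp only [Function.uncurry_apply_pair, e] at h2 ⊢
        rw [integral_smul, hw r hr h1 ((integrable_smul_iff hr' _).1 h2), smul_smul]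
    _ = (∫ r in Ioi (0 : ℝ), r ^ (-α) * w r) • L := integral_smul_const _ _

theorem integral_rpow_smul_comp_mul (R : ℝ → 𝒜) {δ r : ℝ} (hr : 0 < r) :
    ∫ μ in Ioi (0 : ℝ), μ ^ (-δ) • R (r * μ) = r ^ (δ - 1) • stieltjes R δ := by
  have h := integral_comp_mul_left_Ioi (fun l : ℝ => l ^ (-δ) • R l) 0 hr
  rw [mul_zero] at h
  have e : ∫ μ in Ioi (0 : ℝ), μ ^ (-δ) • R (r * μ)
      = ∫ μ in Ioi (0 : ℝ), r ^ δ • ((r * μ) ^ (-δ) • R (r * μ)) := by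
    refine setIntegral_congr_fun measurableSet_Ioi fun μ hμ => ?_
    have hμ' : (0 : ℝ) < μ := hμ
    have : r ^ δ * r ^ (-δ) = 1 := by rw [← Real.rpow_add hr, add_neg_cancel, Real.rpow_zero]
    simp only [smul_smul]
    rw [Real.mul_rpow hr.le hμ'.le, ← mul_assoc, this, one_mul]
  rw [e, integral_smul, h, smul_smul, Real.rpow_sub_one hr.ne', div_eq_mul_inv]
  rfl

theorem integrableOn_comp_mul (hR : IsResolventFamily R) {δ r : ℝ} (hδ : δ ∈ Ioo (0 : ℝ) 1)
    (hr : 0 < r) : IntegrableOn (fun μ : ℝ => μ ^ (-δ) • R (r * μ)) (Ioi 0) := by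
  have h := (integrableOn_Ioi_comp_mul_left_iff (fun l : ℝ => l ^ (-δ) • R l) 0 hr).2
    (by simpa using hR.integrableOn hδ)
  refine IntegrableOn.congr_fun (Integrable.smul (r ^ δ) h) (fun μ hμ => ?_) measurableSet_Ioi
  have hμ' : (0 : ℝ) < μ := hμ
  have : r ^ δ * r ^ (-δ) = 1 := by rw [← Real.rpow_add hr, add_neg_cancel, Real.rpow_zero]
  simp only [smul_smul, Pi.smul_apply]
  rw [Real.mul_rpow hr.le hμ'.le, ← mul_assoc, this, one_mul]

variable [CompleteSpace 𝒜]

/-- For `r ≠ 1`, `(r μ + A)⁻¹ (μ + A)⁻¹` is the difference of the two resolvents divided by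
`(r - 1) μ`. The two terms are integrated separately, which needs `α + β < 1`. -/
theorem stieltjes_mul_of_add_lt_one (hR : IsResolventFamily R) {α β : ℝ} (hα : 0 < α) (hβ : 0 < β)
    (h : α + β < 1) :
    stieltjes R α * stieltjes R β = (∫ r in Ioi (0 : ℝ),
      r ^ (-α) * ((1 - r ^ (α + β - 1)) / (r - 1))) • stieltjes R (α + β) := by
  have hγ : α + β ∈ Ioo (0 : ℝ) 1 := ⟨by positivity, h⟩
  refine hR.stieltjes_mul_stieltjes_of_inner ⟨hα, by linarith⟩ ⟨hβ, by linarith⟩ _ _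
    fun r hr hr1 _ => ?_
  have e : ∫ μ in Ioi (0 : ℝ), μ ^ (1 - (α + β)) • (R (r * μ) * R μ)
      = ∫ μ in Ioi (0 : ℝ), (r - 1)⁻¹ •
          (μ ^ (-(α + β)) • R μ - μ ^ (-(α + β)) • R (r * μ)) := by
    refine setIntegral_congr_fun measurableSet_Ioi fun μ hμ => ?_
    have hμ' : (0 : ℝ) < μ := hμ
    have hs := hR.sub_eq (r * μ) μ (by positivity) hμ'.le
    have hne : r - 1 ≠ 0 := sub_ne_zero.2 hr1
    rw [← smul_sub, ← neg_sub (R (r * μ)), hs, ← neg_smul, smul_smul, smul_smul,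
      sub_eq_add_neg 1, Real.rpow_add hμ', Real.rpow_one]
    congr 1
    field_simp
    ring
  rw [e, integral_smul, integral_sub (hR.integrableOn hγ) (hR.integrableOn_comp_mul hγ hr),
    integral_rpow_smul_comp_mul R hr, ← stieltjes, div_eq_inv_mul, mul_smul, sub_smul,
    one_smul]

/-- In the borderline case `α + β = 1` the inner integral is a Frullani integral, with the limits
`R 0` and `0` of `R` at the two ends. -/
theorem stieltjes_mul_of_add_eq_one (hR : IsResolventFamily R) {α β : ℝ} (hα : 0 < α) (hβ : 0 < β)
    (h : α + β = 1) :
    stieltjes R α * stieltjes R β = (∫ r in Ioi (0 : ℝ),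
      r ^ (-α) * (Real.log r / (r - 1))) • R 0 := by
  refine hR.stieltjes_mul_stieltjes_of_inner ⟨hα, by linarith⟩ ⟨hβ, by linarith⟩ _ _
    fun r hr hr1 hi => ?_
  have hne : r - 1 ≠ 0 := sub_ne_zero.2 hr1
  have e' : ∀ μ ∈ Ioi (0 : ℝ), μ ^ (1 - (α + β)) • (R (r * μ) * R μ)
      = (r - 1)⁻¹ • (μ⁻¹ • (R (1 * μ) - R (r * μ))) := by
    intro μ hμ
    have hμ' : (0 : ℝ) < μ := hμ
    have hs := hR.sub_eq (r * μ) μ (by positivity) hμ'.le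
    rw [one_mul, ← neg_sub (R (r * μ)), hs, ← neg_smul, smul_smul, smul_smul, h, sub_self,
      Real.rpow_zero]
    congr 1
    field_simp
    ring
  have hi' : IntegrableOn (fun μ : ℝ => μ⁻¹ • (R (1 * μ) - R (r * μ))) (Ioi 0) :=
    (integrable_smul_iff (inv_ne_zero hne) _).1 (hi.congr_fun e' measurableSet_Ioi)
  have h0 : Filter.Tendsto R (nhdsWithin 0 (Ioi 0)) (nhds (R 0)) :=
    (hR.continuousOn 0 self_mem_Ici).mono_left (nhdsWithin_mono _ Ioi_subset_Ici_self)
  have hinf : Filter.Tendsto R Filter.atTop (nhds 0) := by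
    obtain ⟨K, hK⟩ := hR.bounded
    refine squeeze_zero_norm' (a := fun μ => K / μ) ?_ (tendsto_const_nhds.div_atTop
      Filter.tendsto_id)
    filter_upwards [Filter.eventually_gt_atTop 0] with μ hμ
    rw [le_div_iff₀ hμ, mul_comm]
    exact (hK μ hμ.le).2
  rw [setIntegral_congr_fun measurableSet_Ioi e', integral_smul,
    Frullani.integral_Ioi_eq ((hR.continuousOn.mono Ioi_subset_Ici_self).locallyIntegrableOn
      measurableSet_Ioi) one_pos hr h0 hinf hi', div_one, sub_zero, smul_smul, div_eq_inv_mul]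

/-- For `α + β > 1` the inner integral is split after inserting `R μ = R 0 - μ R 0 R μ`, which
extracts a factor `R 0` and leaves the exponent `α + β - 1`. -/
theorem stieltjes_mul_of_one_lt_add (hR : IsResolventFamily R) {α β : ℝ} (hα : α < 1) (hβ : β < 1)
    (h : 1 < α + β) :
    stieltjes R α * stieltjes R β = (∫ r in Ioi (0 : ℝ),
      r ^ (-α) * ((1 - r ^ (α + β - 1)) / (r - 1))) • -(R 0 * stieltjes R (α + β - 1)) := by
  have hγ : α + β - 1 ∈ Ioo (0 : ℝ) 1 := ⟨by linarith, by linarith⟩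
  refine hR.stieltjes_mul_stieltjes_of_inner ⟨by linarith, hα⟩ ⟨by linarith, hβ⟩ _ _
    fun r hr hr1 _ => ?_
  have hne : r - 1 ≠ 0 := sub_ne_zero.2 hr1
  have e : ∫ μ in Ioi (0 : ℝ), μ ^ (1 - (α + β)) • (R (r * μ) * R μ)
      = ∫ μ in Ioi (0 : ℝ), R 0 * ((r - 1)⁻¹ •
          (r • μ ^ (-(α + β - 1)) • R (r * μ) - μ ^ (-(α + β - 1)) • R μ)) := by
    refine setIntegral_congr_fun measurableSet_Ioi fun μ hμ => ?_
    have hμ' : (0 : ℝ) < μ := hμ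
    have hs := hR.sub_eq (r * μ) μ (by positivity) hμ'.le
    have h1 := hR.sub_eq 0 (r * μ) le_rfl (by positivity)
    have h2 := hR.sub_eq 0 μ le_rfl hμ'.le
    rw [sub_zero] at h1 h2
    have h3 : R 0 * (r • R (r * μ) - R μ) = (r - 1) • (R (r * μ) * R μ) := by
      refine smul_right_injective 𝒜 hμ'.ne' ?_
      simp only
      rw [mul_sub, smul_sub, mul_smul_comm, smul_smul, mul_comm μ r, ← h1, ← h2, smul_smul,
        sub_sub_sub_cancel_left, ← neg_sub, hs, ← neg_smul]
      congr 1
      ring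
    rw [smul_comm r, ← smul_sub, mul_smul_comm, mul_smul_comm, h3, smul_smul, smul_smul,
      neg_sub]
    congr 1
    field_simp
  have i1 := hR.integrableOn hγ
  have i2 := hR.integrableOn_comp_mul hγ hr
  have hrr : r * r ^ (α + β - 1 - 1) = r ^ (α + β - 1) := by
    rw [Real.rpow_sub_one hr.ne' (α + β - 1)]
    field_simp
  have i3 : IntegrableOn (fun μ : ℝ => (r - 1)⁻¹ •
      (r • μ ^ (-(α + β - 1)) • R (r * μ) - μ ^ (-(α + β - 1)) • R μ)) (Ioi 0) :=
    ((i2.smul r).sub i1).smul (r - 1)⁻¹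
  have i4 : IntegrableOn (fun μ : ℝ => r • μ ^ (-(α + β - 1)) • R (r * μ)) (Ioi 0) := i2.smul r
  rw [e, integral_const_mul_of_integrable i3, integral_smul,
    integral_sub i4 i1, integral_smul, integral_rpow_smul_comp_mul R hr, ← stieltjes,
    smul_smul, hrr, mul_smul_comm, smul_neg, ← neg_smul]
  have : r ^ (α + β - 1) • stieltjes R (α + β - 1) - stieltjes R (α + β - 1)
      = (r ^ (α + β - 1) - 1) • stieltjes R (α + β - 1) := by rw [sub_smul, one_smul]
  rw [this, mul_smul_comm, smul_smul]
  congr 1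
  field_simp
  ring

/-- The semigroup law for the Balakrishnan integrals, for exponents with sum less than one. The
scalar factor in `stieltjes_mul_of_add_lt_one` does not depend on the resolvent family, so it is
found from the family `(1 + μ)⁻¹` in `ℝ`; the other two cases are normalised in the same way. -/
theorem balakrishnan_mul_of_add_lt_one (hR : IsResolventFamily R) {α β : ℝ} (hα : 0 < α)
    (hβ : 0 < β) (h : α + β < 1) :
    balakrishnan R α * balakrishnan R β = balakrishnan R (α + β) := by
  have h1 := isResolventFamily_inv_one_add.stieltjes_mul_of_add_lt_one hα hβ h
  have hα' : α ∈ Ioo (0 : ℝ) 1 := ⟨hα, by linarith⟩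
  have hβ' : β ∈ Ioo (0 : ℝ) 1 := ⟨hβ, by linarith⟩
  have hγ : α + β ∈ Ioo (0 : ℝ) 1 := ⟨by positivity, h⟩
  rw [stieltjes_inv_one_add hα', stieltjes_inv_one_add hβ', stieltjes_inv_one_add hγ,
    smul_eq_mul] at h1
  have cα := balakrishnanConst_pos hα'
  have cβ := balakrishnanConst_pos hβ'
  have cγ := balakrishnanConst_pos hγ
  rw [balakrishnan, balakrishnan, smul_mul_smul_comm, hR.stieltjes_mul_of_add_lt_one hα hβ h,
    smul_smul, balakrishnan]
  congr 1
  field_simp at h1 ⊢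
  exact h1.symm

theorem balakrishnan_mul_of_add_eq_one (hR : IsResolventFamily R) {α β : ℝ} (hα : 0 < α)
    (hβ : 0 < β) (h : α + β = 1) :
    balakrishnan R α * balakrishnan R β = R 0 := by
  have h1 := isResolventFamily_inv_one_add.stieltjes_mul_of_add_eq_one hα hβ h
  have hα' : α ∈ Ioo (0 : ℝ) 1 := ⟨hα, by linarith⟩
  have hβ' : β ∈ Ioo (0 : ℝ) 1 := ⟨hβ, by linarith⟩
  rw [stieltjes_inv_one_add hα', stieltjes_inv_one_add hβ', smul_eq_mul, add_zero, inv_one,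
    mul_one] at h1
  have cα := balakrishnanConst_pos hα'
  have cβ := balakrishnanConst_pos hβ'
  rw [balakrishnan, balakrishnan, smul_mul_smul_comm, hR.stieltjes_mul_of_add_eq_one hα hβ h,
    smul_smul, ← h1]
  have : balakrishnanConst α * balakrishnanConst β *
      ((balakrishnanConst α)⁻¹ * (balakrishnanConst β)⁻¹) = 1 := by field_simp
  rw [this, one_smul]

theorem balakrishnan_mul_of_one_lt_add (hR : IsResolventFamily R) {α β : ℝ} (hα : α < 1)
    (hβ : β < 1) (h : 1 < α + β) :
    balakrishnan R α * balakrishnan R β = R 0 * balakrishnan R (α + β - 1) := by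
  have h1 := isResolventFamily_inv_one_add.stieltjes_mul_of_one_lt_add hα hβ h
  have hα' : α ∈ Ioo (0 : ℝ) 1 := ⟨by linarith, hα⟩
  have hβ' : β ∈ Ioo (0 : ℝ) 1 := ⟨by linarith, hβ⟩
  have hγ : α + β - 1 ∈ Ioo (0 : ℝ) 1 := ⟨by linarith, by linarith⟩
  rw [stieltjes_inv_one_add hα', stieltjes_inv_one_add hβ', stieltjes_inv_one_add hγ,
    smul_eq_mul, add_zero, inv_one, one_mul] at h1
  have cα := balakrishnanConst_pos hα'
  have cβ := balakrishnanConst_pos hβ'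
  have cγ := balakrishnanConst_pos hγ
  rw [balakrishnan, balakrishnan, smul_mul_smul_comm, hR.stieltjes_mul_of_one_lt_add hα hβ h,
    smul_smul, balakrishnan, smul_neg, ← neg_smul, mul_smul_comm]
  congr 1
  field_simp at h1 ⊢
  linarith

end IsResolventFamily

end BanachAlgebra

/-! ### Sinc quadrature for functions holomorphic on a strip -/

/-- Functions on the closed strip `|Im z| ≤ π / 2`, holomorphic inside, that decay exponentially
at both ends of the strip, with rates `a` on the left and `b` on the right. -/
structure IsStripDecaying {E : Type*} [NormedAddCommGroup E] [NormedSpace ℂ E]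
    (F : ℂ → E) (K a b : ℝ) : Prop where
  continuousOn : ContinuousOn F {z | |z.im| ≤ Real.pi / 2}
  differentiableOn : DifferentiableOn ℂ F {z | |z.im| < Real.pi / 2}
  norm_le_left : ∀ z : ℂ, |z.im| ≤ Real.pi / 2 → ‖F z‖ ≤ K * Real.exp (a * z.re)
  norm_le_right : ∀ z : ℂ, |z.im| ≤ Real.pi / 2 → ‖F z‖ ≤ K * Real.exp (-b * z.re)

/-- The two exponential bounds are used on the negative and the positive half-line. -/
theorem integrable_and_integral_norm_le_of_exp_decay {E : Type*} [NormedAddCommGroup E]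
    {φ : ℝ → E} (hφ : Continuous φ) {K a b : ℝ} (ha : 0 < a) (hb : 0 < b)
    (hl : ∀ x, ‖φ x‖ ≤ K * Real.exp (a * x)) (hr : ∀ x, ‖φ x‖ ≤ K * Real.exp (-b * x)) :
    Integrable φ ∧ ∫ x, ‖φ x‖ ≤ K * (1 / a + 1 / b) := by
  have i₁ := (integrableOn_exp_mul_Iic ha 0).const_mul K
  have i₂ := (integrableOn_exp_mul_Ioi (neg_lt_zero.2 hb) 0).const_mul K
  have f₁ : IntegrableOn φ (Iic 0) :=
    Integrable.mono' i₁ hφ.aestronglyMeasurable (Filter.Eventually.of_forall hl)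
  have f₂ : IntegrableOn φ (Ioi 0) :=
    Integrable.mono' i₂ hφ.aestronglyMeasurable (Filter.Eventually.of_forall hr)
  have f : Integrable φ := by
    rw [← integrableOn_univ, ← Iic_union_Ioi (a := (0 : ℝ))]
    exact f₁.union f₂
  refine ⟨f, ?_⟩
  rw [← intervalIntegral.integral_Iic_add_Ioi f₁.norm f₂.norm]
  have e₁ := setIntegral_mono f₁.norm i₁ hl
  have e₂ := setIntegral_mono f₂.norm i₂ hr
  rw [integral_const_mul, integral_exp_mul_Iic ha] at e₁
  rw [integral_const_mul, integral_exp_mul_Ioi (neg_lt_zero.2 hb)] at e₂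
  refine (add_le_add e₁ e₂).trans (le_of_eq ?_)
  simp only [mul_zero, Real.exp_zero]
  field_simp

/-- The geometric series over both tails of `ℤ`. -/
theorem hasSum_int_exp_tails {A B : ℝ} (hA : 0 < A) (hB : 0 < B) (M N : ℕ) :
    HasSum (fun l : ℤ => (if (N : ℤ) < l then Real.exp (-B * l) else 0)
        + if l < -(M : ℤ) then Real.exp (A * l) else 0)
      (Real.exp (-B * N) * (Real.exp B - 1)⁻¹ + Real.exp (-A * M) * (Real.exp A - 1)⁻¹) := by
  have geom : ∀ {D : ℝ}, 0 < D → ∀ L : ℕ,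
      HasSum (fun n : ℕ => Real.exp (-D * ((L : ℝ) + 1 + n)))
        (Real.exp (-D * L) * (Real.exp D - 1)⁻¹) := by
    intro D hD L
    have h1 : Real.exp (-D) < 1 := by simpa using hD
    have h2 : 1 < Real.exp D := by simpa using hD
    have h := (hasSum_geometric_of_lt_one (Real.exp_pos _).le h1).mul_left
      (Real.exp (-D * ((L : ℝ) + 1)))
    have e : Real.exp (-D * ((L : ℝ) + 1)) * (1 - Real.exp (-D))⁻¹
        = Real.exp (-D * L) * (Real.exp D - 1)⁻¹ := by
      have h3 : Real.exp D - 1 ≠ 0 := by linarith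
      have h4 := Real.exp_pos D
      rw [mul_add, mul_one, Real.exp_add, Real.exp_neg D, mul_assoc, ← mul_inv, mul_sub, mul_one,
        mul_inv_cancel₀ h4.ne']
    rw [e] at h
    refine h.congr_fun fun n => ?_
    rw [← Real.exp_nat_mul, ← Real.exp_add]
    congr 1
    ring
  refine HasSum.add ?_ ?_
  · have hinj : Function.Injective fun n : ℕ => (N : ℤ) + 1 + n := fun m n h => by
      simpa using h
    refine (hinj.hasSum_iff fun l hl => ?_).1 ?_
    · refine if_neg fun h => hl ⟨(l - (N + 1)).toNat, ?_⟩
      simp only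
      omega
    · refine (geom hB N).congr_fun fun n => ?_
      have : (N : ℤ) < (N : ℤ) + 1 + n := by omega
      simp [this]
  · have hinj : Function.Injective fun n : ℕ => -((M : ℤ) + 1 + n) := fun m n h => by
      simpa using h
    refine (hinj.hasSum_iff fun l hl => ?_).1 ?_
    · refine if_neg fun h => hl ⟨(-l - (M + 1)).toNat, ?_⟩
      simp only
      omega
    · refine (geom hA M).congr_fun fun n => ?_
      have : -((M : ℤ) + 1 + n) < -(M : ℤ) := by omega
      simp only [Function.comp_apply, this, if_true]
      push_cast
      congr 1
      ring

namespace IsStripDecaying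

variable {E : Type*} [NormedAddCommGroup E] [NormedSpace ℂ E] {F : ℂ → E} {K a b : ℝ}

theorem continuous_comp_add (hF : IsStripDecaying F K a b) {c : ℝ} (hc : |c| ≤ Real.pi / 2) :
    Continuous fun x : ℝ => F (x + c * Complex.I) := by
  refine hF.continuousOn.comp_continuous (by fun_prop) fun x => ?_
  simpa using hc

theorem integrable_and_integral_norm_le (hF : IsStripDecaying F K a b) (ha : 0 < a) (hb : 0 < b)
    {c : ℝ} (hc : |c| ≤ Real.pi / 2) :
    Integrable (fun x : ℝ => F (x + c * Complex.I)) ∧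
      ∫ x : ℝ, ‖F (x + c * Complex.I)‖ ≤ K * (1 / a + 1 / b) := by
  refine integrable_and_integral_norm_le_of_exp_decay (hF.continuous_comp_add hc) ha hb ?_ ?_
  · intro x
    simpa using hF.norm_le_left (x + c * Complex.I) (by simpa using hc)
  · intro x
    simpa using hF.norm_le_right (x + c * Complex.I) (by simpa using hc)

/-- The line of integration can be moved within the strip: Cauchy's theorem for a rectangle
whose vertical sides move to infinity. -/
theorem integral_comp_add_eq (hF : IsStripDecaying F K a b) (ha : 0 < a) (hb : 0 < b)
    {c : ℝ} (hc : |c| ≤ Real.pi / 2) :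
    ∫ x : ℝ, F (x + c * Complex.I) = ∫ x : ℝ, F x := by
  have hpi : 0 < Real.pi / 2 := by positivity
  have hin : ∀ y ∈ uIcc 0 c, |y| ≤ Real.pi / 2 := fun y hy => by
    have := abs_sub_left_of_mem_uIcc hy
    simp only [sub_zero] at this
    exact this.trans hc
  have hrect : ∀ T : ℝ, (∫ x : ℝ in -T..T, F (x + (0 : ℝ) * Complex.I))
      - (∫ x : ℝ in -T..T, F (x + c * Complex.I))
      = Complex.I • (∫ y : ℝ in (0 : ℝ)..c, F ((-T : ℝ) + y * Complex.I))
        - Complex.I • ∫ y : ℝ in (0 : ℝ)..c, F (T + y * Complex.I) := by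
    intro T
    have h := Complex.integral_boundary_rect_eq_zero_of_continuousOn_of_differentiableOn F
      ((-T : ℝ) : ℂ) (T + c * Complex.I) (hF.continuousOn.mono ?_) (hF.differentiableOn.mono ?_)
    · simp only [Complex.ofReal_re, Complex.ofReal_im, Complex.add_re, Complex.add_im,
        Complex.mul_re, Complex.mul_im, Complex.I_re, Complex.I_im, mul_zero, mul_one, sub_zero,
        add_zero, zero_add] at h
      rw [← sub_eq_zero, ← h]
      abel
    · rintro z ⟨-, hz⟩
      exact hin _ (by simpa using hz)
    · rintro z ⟨-, hz⟩
      have hz1 : min 0 c < z.im := by simpa using hz.1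
      have hz2 : z.im < max 0 c := by simpa using hz.2
      have := abs_le.1 hc
      refine abs_lt (a := z.im).2 ⟨?_, ?_⟩
      · exact (le_min (by linarith) this.1).trans_lt hz1
      · exact hz2.trans_le (max_le hpi.le this.2)
  have i0 := (hF.integrable_and_integral_norm_le ha hb (c := 0) (by simpa using hpi.le)).1
  have ic := (hF.integrable_and_integral_norm_le ha hb hc).1
  have l1 := (intervalIntegral_tendsto_integral i0 Filter.tendsto_neg_atTop_atBot
    Filter.tendsto_id).sub (intervalIntegral_tendsto_integral ic Filter.tendsto_neg_atTop_atBot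
    Filter.tendsto_id)
  have exp0 : ∀ {d : ℝ}, 0 < d →
      Filter.Tendsto (fun T : ℝ => K * Real.exp (-d * T) * |c - 0|) Filter.atTop (nhds 0) := by
    intro d hd
    have h1 : Filter.Tendsto (fun T : ℝ => Real.exp (-d * T)) Filter.atTop (nhds 0) :=
      Real.tendsto_exp_atBot.comp
        (Filter.tendsto_id.const_mul_atTop_of_neg (neg_lt_zero.2 hd))
    simpa using (h1.const_mul K).mul_const |c - 0|
  have v1 : Filter.Tendsto (fun T : ℝ => ∫ y : ℝ in (0 : ℝ)..c, F ((-T : ℝ) + y * Complex.I))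
      Filter.atTop (nhds 0) := by
    refine squeeze_zero_norm (fun T => ?_) (exp0 ha)
    refine intervalIntegral.norm_integral_le_of_norm_le_const fun y hy => ?_
    have := hF.norm_le_left ((-T : ℝ) + y * Complex.I)
      (by simpa using hin y (uIoc_subset_uIcc hy))
    simpa using this
  have v2 : Filter.Tendsto (fun T : ℝ => ∫ y : ℝ in (0 : ℝ)..c, F (T + y * Complex.I))
      Filter.atTop (nhds 0) := by
    refine squeeze_zero_norm (fun T => ?_) (exp0 hb)
    refine intervalIntegral.norm_integral_le_of_norm_le_const fun y hy => ?_
    have := hF.norm_le_right (T + y * Complex.I) (by simpa using hin y (uIoc_subset_uIcc hy))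
    simpa using this
  have l2 := (v1.const_smul Complex.I).sub (v2.const_smul Complex.I)
  have l3 := l1.congr hrect
  have := tendsto_nhds_unique l3 l2
  simp only [Complex.ofReal_zero, zero_mul, add_zero, smul_zero, sub_zero] at this
  exact (sub_eq_zero.1 this).symm

/-- Multiplication with a character of the real axis, extended to the strip, keeps the decay
rates, because the character is bounded on the strip. -/
theorem exp_mul {G : ℂ → ℂ} (hG : IsStripDecaying G K a b) (ξ : ℝ) :
    IsStripDecaying (fun z => Complex.exp (-2 * Real.pi * ξ * z * Complex.I) * G z)
      (Real.exp (Real.pi ^ 2 * |ξ|) * K) a b := by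
  have hn : ∀ z : ℂ, |z.im| ≤ Real.pi / 2 →
      ‖Complex.exp (-2 * Real.pi * ξ * z * Complex.I)‖ ≤ Real.exp (Real.pi ^ 2 * |ξ|) := by
    intro z hz
    rw [Complex.norm_exp]
    refine Real.exp_le_exp.2 ?_
    have h1 : (-2 * Real.pi * ξ * z * Complex.I).re = 2 * Real.pi * (ξ * z.im) := by
      simp [Complex.mul_re, Complex.mul_im]
      ring
    rw [h1]
    have h2 : ξ * z.im ≤ |ξ| * (Real.pi / 2) := by
      refine (le_abs_self _).trans ?_
      rw [abs_mul]
      gcongr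
    nlinarith [Real.pi_pos]
  refine ⟨ContinuousOn.mul (by fun_prop) hG.continuousOn,
    DifferentiableOn.mul (by fun_prop) hG.differentiableOn, fun z hz => ?_, fun z hz => ?_⟩
  · rw [norm_mul, mul_assoc (Real.exp _)]
    exact mul_le_mul (hn z hz) (hG.norm_le_left z hz) (norm_nonneg _) (Real.exp_pos _).le
  · rw [norm_mul, mul_assoc (Real.exp _)]
    exact mul_le_mul (hn z hz) (hG.norm_le_right z hz) (norm_nonneg _) (Real.exp_pos _).le

/-- The Fourier transform of the restriction to the real axis decays like `exp (-π² |ξ|)`: move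
the line of integration to the edge of the strip on which the exponential is smallest. -/
theorem norm_integral_exp_mul_le {G : ℂ → ℂ} (hG : IsStripDecaying G K a b) (ha : 0 < a)
    (hb : 0 < b) (ξ : ℝ) :
    ‖∫ x : ℝ, Complex.exp (-2 * Real.pi * ξ * x * Complex.I) * G x‖
      ≤ Real.exp (-(Real.pi ^ 2 * |ξ|)) * (K * (1 / a + 1 / b)) := by
  have hpi := Real.pi_pos
  obtain ⟨c, hc, hξ⟩ : ∃ c : ℝ, |c| ≤ Real.pi / 2 ∧
      2 * Real.pi * (ξ * c) = -(Real.pi ^ 2 * |ξ|) := by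
    rcases le_total 0 ξ with h | h
    · refine ⟨-(Real.pi / 2), ?_, ?_⟩
      · rw [abs_neg, abs_of_pos (by positivity)]
      · rw [abs_of_nonneg h]; ring
    · refine ⟨Real.pi / 2, ?_, ?_⟩
      · rw [abs_of_pos (by positivity)]
      · rw [abs_of_nonpos h]; ring
  rw [← (hG.exp_mul ξ).integral_comp_add_eq ha hb hc]
  refine (norm_integral_le_integral_norm _).trans ?_
  have e : ∀ x : ℝ, ‖Complex.exp (-2 * Real.pi * ξ * (x + c * Complex.I) * Complex.I)
        * G (x + c * Complex.I)‖
      = Real.exp (-(Real.pi ^ 2 * |ξ|)) * ‖G (x + c * Complex.I)‖ := by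
    intro x
    rw [norm_mul, Complex.norm_exp, ← hξ]
    congr 2
    simp [Complex.mul_re, Complex.mul_im]
    ring
  simp only [e]
  rw [integral_const_mul]
  exact mul_le_mul_of_nonneg_left (hG.integrable_and_integral_norm_le ha hb hc).2
    (Real.exp_pos _).le

theorem nonneg (hF : IsStripDecaying F K a b) : 0 ≤ K := by
  have := (norm_nonneg _).trans (hF.norm_le_left 0 (by simpa using by positivity))
  simpa using this

/-- The error of the trapezoidal rule on the whole line, by Poisson summation. -/
theorem exists_hasSum_norm_integral_sub_le {G : ℂ → ℂ} (hG : IsStripDecaying G K a b) (ha : 0 < a)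
    (hb : 0 < b) {k : ℝ} (hk : 0 < k) :
    ∃ S : ℂ, HasSum (fun l : ℤ => G ((l * k : ℝ))) S ∧
      ‖(∫ x : ℝ, G x) - k * S‖ ≤ K * (1 / a + 1 / b) *
        ((Real.sinh (Real.pi ^ 2 / (2 * k)))⁻¹ * Real.exp (-(Real.pi ^ 2 / (2 * k)))) := by
  have hpi := Real.pi_pos
  have hK := hG.nonneg
  set f : ℝ → ℂ := fun x => G ((x * k : ℝ)) with hf
  have hcont : Continuous f := by
    have h0 := hG.continuous_comp_add (c := 0) (by simpa using by positivity)
    simp only [Complex.ofReal_zero, zero_mul, add_zero] at h0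
    exact h0.comp (continuous_id.mul continuous_const)
  have hle : ∀ x, ‖f x‖ ≤ K * Real.exp (-(min a b * k) * |x|) := by
    intro x
    have hz : |((x * k : ℝ) : ℂ).im| ≤ Real.pi / 2 := by simpa using by positivity
    have hxk : min a b * (|x| * k) ≤ b * (|x| * k) := by gcongr; exact min_le_right _ _
    have hxk' : min a b * (|x| * k) ≤ a * (|x| * k) := by gcongr; exact min_le_left _ _
    rcases le_total 0 x with hx | hx
    · refine (hG.norm_le_right _ hz).trans ?_
      rw [Complex.ofReal_re]
      rw [abs_of_nonneg hx] at hxk ⊢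
      refine mul_le_mul_of_nonneg_left (Real.exp_le_exp.2 ?_) hK
      linarith
    · refine (hG.norm_le_left _ hz).trans ?_
      rw [Complex.ofReal_re]
      rw [abs_of_nonpos hx] at hxk' ⊢
      refine mul_le_mul_of_nonneg_left (Real.exp_le_exp.2 ?_) hK
      linarith
  set d := min a b * k with hd
  have hd0 : 0 < d := mul_pos (lt_min ha hb) hk
  -- Poisson summation asks for polynomial decay only: use `(d |x|)² / 2 ≤ exp (d |x|)`
  have hO : f =O[Filter.cocompact ℝ] fun x => |x| ^ (-2 : ℝ) := by
    refine Asymptotics.IsBigO.of_bound (K * (2 / d ^ 2)) ?_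
    filter_upwards [(isCompact_singleton (x := (0 : ℝ))).compl_mem_cocompact] with x hx
    have hx0 : 0 < |x| := abs_pos.2 (by simpa using hx)
    refine (hle x).trans ?_
    rw [mul_assoc]
    refine mul_le_mul_of_nonneg_left ?_ hK
    rw [Real.norm_of_nonneg (Real.rpow_nonneg hx0.le _), Real.rpow_neg hx0.le, Real.rpow_two,
      neg_mul, Real.exp_neg, ← div_eq_mul_inv, div_div, ← mul_pow, inv_le_comm₀ (Real.exp_pos _)
      (by positivity), inv_div]
    have := Real.quadratic_le_exp_of_nonneg (x := d * |x|) (by positivity)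
    have h2 : 0 ≤ d * |x| := by positivity
    linarith
  have hfour : ∀ n : ℤ, FourierTransform.fourier f (n : ℝ) = (k⁻¹ : ℝ) •
      ∫ x : ℝ, Complex.exp (-2 * Real.pi * ((n / k : ℝ) : ℂ) * x * Complex.I) * G x := by
    intro n
    rw [Real.fourier_real_eq_integral_exp_smul]
    have h := Measure.integral_comp_mul_right
      (fun x : ℝ => Complex.exp (-2 * Real.pi * ((n / k : ℝ) : ℂ) * x * Complex.I) * G x) k
    rw [abs_of_pos (inv_pos.2 hk)] at h
    rw [← h]
    congr 1
    ext x
    simp only [hf, smul_eq_mul]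
    congr 2
    push_cast
    have : (k : ℂ) ≠ 0 := by exact_mod_cast hk.ne'
    field_simp
  have hfle : ∀ n : ℤ, ‖FourierTransform.fourier f (n : ℝ)‖
      ≤ k⁻¹ * (K * (1 / a + 1 / b)) * Real.exp (-(Real.pi ^ 2 / k * |(n : ℝ)|)) := by
    intro n
    rw [hfour, norm_smul, Real.norm_of_nonneg (by positivity), mul_assoc k⁻¹]
    refine mul_le_mul_of_nonneg_left ?_ (by positivity)
    refine (hG.norm_integral_exp_mul_le ha hb _).trans (le_of_eq ?_)
    rw [abs_div, abs_of_pos hk, mul_comm]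
    congr 3
    ring
  have hA : 0 < Real.pi ^ 2 / k := by positivity
  have htail := (hasSum_int_exp_tails hA hA 0 0).mul_left (k⁻¹ * (K * (1 / a + 1 / b)))
  -- the term `n = 0` is the integral itself, so it is removed from the dual series
  have hne : ∀ n : ℤ, ‖FourierTransform.fourier f (n : ℝ)
        - if n = 0 then FourierTransform.fourier f (0 : ℝ) else 0‖
      ≤ k⁻¹ * (K * (1 / a + 1 / b)) *
        ((if ((0 : ℕ) : ℤ) < n then Real.exp (-(Real.pi ^ 2 / k) * n) else 0)
        + if n < -((0 : ℕ) : ℤ) then Real.exp (Real.pi ^ 2 / k * n) else 0) := by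
    intro n
    rcases lt_trichotomy n 0 with h | h | h
    · have h' : (n : ℝ) < 0 := by exact_mod_cast h
      have := hfle n
      rw [abs_of_neg h'] at this
      simpa [h, h.ne, not_lt.2 h.le] using this
    · simp [h]
    · have h' : (0 : ℝ) < n := by exact_mod_cast h
      have := hfle n
      rw [abs_of_pos h'] at this
      simpa [h, h.ne', not_lt.2 h.le] using this
  have hsum0 : HasSum (fun n : ℤ => if n = 0 then FourierTransform.fourier f (0 : ℝ) else 0)
      (FourierTransform.fourier f (0 : ℝ)) := hasSum_ite_eq 0 _
  have hsd : Summable fun n : ℤ => FourierTransform.fourier f (n : ℝ)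
      - if n = 0 then FourierTransform.fourier f (0 : ℝ) else 0 :=
    Summable.of_norm_bounded htail.summable hne
  have hsF : Summable fun n : ℤ => FourierTransform.fourier f (n : ℝ) := by
    simpa using hsd.add hsum0.summable
  have hpois := Real.tsum_eq_tsum_fourier_of_rpow_decay_of_summable hcont one_lt_two hO hsF 0
  simp only [zero_add, QuotientAddGroup.mk_zero, fourier_eval_zero, mul_one] at hpois
  have hsf : Summable fun l : ℤ => f l := by
    have h := (hasSum_int_exp_tails hd0 hd0 0 0).mul_left K
    refine Summable.of_norm_bounded (h.summable.add (hasSum_ite_eq (0 : ℤ) K).summable) fun n => ?_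
    rcases lt_trichotomy n 0 with h | h | h
    · have h' : (n : ℝ) < 0 := by exact_mod_cast h
      have := hle n
      rw [abs_of_neg h'] at this
      simpa [h, h.ne, not_lt.2 h.le] using this
    · have := hle n
      simpa [h] using this
    · have h' : (0 : ℝ) < n := by exact_mod_cast h
      have := hle n
      rw [abs_of_pos h'] at this
      simpa [h, h.ne', not_lt.2 h.le] using this
  refine ⟨_, hsf.hasSum, ?_⟩
  have hF0 : (∫ x : ℝ, G x) = k * FourierTransform.fourier f (0 : ℝ) := by
    have h := hfour 0
    have hk' : (k : ℂ) ≠ 0 := by exact_mod_cast hk.ne'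
    simp only [Int.cast_zero, zero_div, Complex.ofReal_zero, mul_zero, zero_mul, Complex.exp_zero,
      one_mul] at h
    rw [h, Complex.real_smul, Complex.ofReal_inv, mul_inv_cancel_left₀ hk']
  have hdiff : (∫ x : ℝ, G x) - k * ∑' l : ℤ, f l
      = -(k * ∑' n : ℤ, (FourierTransform.fourier f (n : ℝ)
        - if n = 0 then FourierTransform.fourier f (0 : ℝ) else 0)) := by
    rw [hF0, hpois, (hsF.hasSum.sub hsum0).tsum_eq]
    ring
  rw [hdiff, norm_neg, norm_mul, Complex.norm_real, Real.norm_of_nonneg hk.le]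
  refine (mul_le_mul_of_nonneg_left (hsd.hasSum.norm_le_of_bounded htail hne) hk.le).trans
    (le_of_eq ?_)
  have hx : 0 < Real.pi ^ 2 / (2 * k) := by positivity
  have hy : Real.pi ^ 2 / k = Real.pi ^ 2 / (2 * k) + Real.pi ^ 2 / (2 * k) := by
    field_simp
    ring
  rw [hy]
  set x := Real.pi ^ 2 / (2 * k)
  have h1 : 1 < Real.exp x := by simpa using hx
  have h2 : Real.exp x * Real.exp x - 1 ≠ 0 := by nlinarith
  have h3 : Real.exp x - (Real.exp x)⁻¹ ≠ 0 := by
    have : (Real.exp x)⁻¹ < 1 := inv_lt_one_of_one_lt₀ h1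
    linarith
  rw [Real.sinh_eq, Real.exp_neg, Real.exp_add]
  simp only [CharP.cast_eq_zero, mul_zero, Real.exp_zero, one_mul]
  have e : ((Real.exp x - (Real.exp x)⁻¹) / 2)⁻¹ * (Real.exp x)⁻¹
      = 2 * (Real.exp x * Real.exp x - 1)⁻¹ := by
    have h4 := Real.exp_pos x
    rw [inv_div, div_mul_eq_mul_div, div_eq_mul_inv, mul_assoc, ← mul_inv, mul_sub,
      mul_inv_cancel₀ h4.ne']
  rw [e]
  field_simp
  ring

/-- The error of the truncated sinc quadrature, for scalar functions: the error of the full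
trapezoidal rule, plus two geometric tails with `k / (e^{c k} - 1) ≤ 1 / c`. -/
theorem norm_integral_sub_sum_le_of_scalar {G : ℂ → ℂ} (hG : IsStripDecaying G K a b) (ha : 0 < a)
    (hb : 0 < b) {k : ℝ} (hk : 0 < k) (M N : ℕ) :
    ‖(∫ x : ℝ, G x) - k * ∑ l ∈ Finset.Icc (-(M : ℤ)) N, G ((l * k : ℝ))‖
      ≤ K * (1 / a + 1 / b) *
        ((Real.sinh (Real.pi ^ 2 / (2 * k)))⁻¹ * Real.exp (-(Real.pi ^ 2 / (2 * k)))
          + Real.exp (-(b * N * k)) + Real.exp (-(a * M * k))) := by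
  have hpi := Real.pi_pos
  have hK := hG.nonneg
  obtain ⟨S, hS, hSle⟩ := hG.exists_hasSum_norm_integral_sub_le ha hb hk
  set s := Finset.Icc (-(M : ℤ)) N with hs
  have hfin : HasSum (fun l : ℤ => if l ∈ s then G ((l * k : ℝ)) else 0)
      (∑ l ∈ s, G ((l * k : ℝ))) := by
    have h := hasSum_sum_of_ne_finset_zero (f := fun l : ℤ => if l ∈ s then G ((l * k : ℝ)) else 0)
      (s := s) (L := SummationFilter.unconditional ℤ) fun l hl => if_neg hl
    rwa [Finset.sum_congr rfl fun l hl => if_pos hl] at h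
  have htail := (hasSum_int_exp_tails (mul_pos ha hk) (mul_pos hb hk) M N).mul_left K
  have hle : ‖S - ∑ l ∈ s, G ((l * k : ℝ))‖
      ≤ K * (Real.exp (-(b * k) * N) * (Real.exp (b * k) - 1)⁻¹
        + Real.exp (-(a * k) * M) * (Real.exp (a * k) - 1)⁻¹) := by
    refine (hS.sub hfin).norm_le_of_bounded htail fun l => ?_
    have hz : |((l * k : ℝ) : ℂ).im| ≤ Real.pi / 2 := by simpa using by positivity
    by_cases h1 : (N : ℤ) < l
    · have h2 : l ∉ s := by rw [hs, Finset.mem_Icc]; omega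
      have h3 : ¬ l < -(M : ℤ) := by omega
      have := hG.norm_le_right _ hz
      rw [if_neg h2, if_pos h1, if_neg h3, sub_zero, add_zero]
      rw [Complex.ofReal_re] at this
      convert this using 3
      ring
    · by_cases h3 : l < -(M : ℤ)
      · have h2 : l ∉ s := by rw [hs, Finset.mem_Icc]; omega
        have := hG.norm_le_left _ hz
        rw [if_neg h2, if_neg h1, if_pos h3, sub_zero, zero_add]
        rw [Complex.ofReal_re] at this
        convert this using 3
        ring
      · have h2 : l ∈ s := by rw [hs, Finset.mem_Icc]; omega
        simp [h1, h2, h3]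
  have hexp : ∀ {c : ℝ}, 0 < c → k * (Real.exp (c * k) - 1)⁻¹ ≤ 1 / c := by
    intro c hc
    have h1 := Real.add_one_le_exp (c * k)
    have h2 : 0 < c * k := by positivity
    rw [← div_eq_mul_inv, div_le_div_iff₀ (by linarith) hc]
    linarith
  have hsplit : (∫ x : ℝ, G x) - k * ∑ l ∈ s, G ((l * k : ℝ))
      = ((∫ x : ℝ, G x) - k * S) + k * (S - ∑ l ∈ s, G ((l * k : ℝ))) := by ring
  rw [hsplit]
  refine (norm_add_le _ _).trans ?_
  rw [norm_mul, Complex.norm_real, Real.norm_of_nonneg hk.le]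
  have h1 := mul_le_mul_of_nonneg_left hle hk.le
  have h2 : k * (K * (Real.exp (-(b * k) * N) * (Real.exp (b * k) - 1)⁻¹
        + Real.exp (-(a * k) * M) * (Real.exp (a * k) - 1)⁻¹))
      ≤ K * (Real.exp (-(b * N * k)) * (1 / b) + Real.exp (-(a * M * k)) * (1 / a)) := by
    have e1 : -(b * k) * N = -(b * N * k) := by ring
    have e2 : -(a * k) * M = -(a * M * k) := by ring
    rw [e1, e2]
    calc _ = K * (Real.exp (-(b * N * k)) * (k * (Real.exp (b * k) - 1)⁻¹)
          + Real.exp (-(a * M * k)) * (k * (Real.exp (a * k) - 1)⁻¹)) := by ring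
      _ ≤ _ := by
        have h1 := hexp ha
        have h2 := hexp hb
        gcongr
  have h3 : K * (Real.exp (-(b * N * k)) * (1 / b) + Real.exp (-(a * M * k)) * (1 / a))
      ≤ K * (1 / a + 1 / b) * (Real.exp (-(b * N * k)) + Real.exp (-(a * M * k))) := by
    rw [mul_assoc K]
    refine mul_le_mul_of_nonneg_left ?_ hK
    have p1 : 0 < Real.exp (-(b * N * k)) := Real.exp_pos _
    have p2 : 0 < Real.exp (-(a * M * k)) := Real.exp_pos _
    have p3 : 0 < 1 / a := by positivity
    have p4 : 0 < 1 / b := by positivity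
    nlinarith [mul_pos p1 p3, mul_pos p2 p4]
  linarith

/-- The error of the truncated sinc quadrature, for Banach space valued functions: apply a norming
functional of the error to reduce to scalar functions. -/
theorem norm_integral_sub_sum_le [CompleteSpace E] (hF : IsStripDecaying F K a b) (ha : 0 < a)
    (hb : 0 < b) {k : ℝ} (hk : 0 < k) (M N : ℕ) :
    ‖(∫ x : ℝ, F x) - k • ∑ l ∈ Finset.Icc (-(M : ℤ)) N, F ((l * k : ℝ))‖
      ≤ K * (1 / a + 1 / b) *
        ((Real.sinh (Real.pi ^ 2 / (2 * k)))⁻¹ * Real.exp (-(Real.pi ^ 2 / (2 * k)))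
          + Real.exp (-(b * N * k)) + Real.exp (-(a * M * k))) := by
  obtain ⟨φ, hφ, hφ'⟩ := exists_dual_vector'' ℂ
    ((∫ x : ℝ, F x) - k • ∑ l ∈ Finset.Icc (-(M : ℤ)) N, F ((l * k : ℝ)))
  have hi : Integrable fun x : ℝ => F x := by
    simpa using (hF.integrable_and_integral_norm_le ha hb (c := 0)
      (by simpa using by positivity)).1
  have hle : ∀ y, ‖φ y‖ ≤ ‖y‖ := fun y => (φ.le_opNorm y).trans
    (mul_le_of_le_one_left (norm_nonneg _) hφ)
  have hG : IsStripDecaying (fun z => φ (F z)) K a b :=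
    ⟨φ.continuous.comp_continuousOn hF.continuousOn,
      φ.differentiable.comp_differentiableOn hF.differentiableOn,
      fun z hz => (hle _).trans (hF.norm_le_left z hz),
      fun z hz => (hle _).trans (hF.norm_le_right z hz)⟩
  have h := hG.norm_integral_sub_sum_le_of_scalar ha hb hk M N
  rw [ContinuousLinearMap.integral_comp_comm φ hi, ← map_sum, ← smul_eq_mul,
    ← map_smul, ← map_sub] at h
  have e : (k : ℂ) • ∑ l ∈ Finset.Icc (-(M : ℤ)) N, F ((l * k : ℝ))
      = k • ∑ l ∈ Finset.Icc (-(M : ℤ)) N, F ((l * k : ℝ)) := by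
    rw [Complex.coe_smul]
  rw [e, hφ'] at h
  simpa using h

end IsStripDecaying

/-! ### Resolvents and negative powers of a regularly accretive operator -/

namespace RegularForm

variable {X Y : Type*} [NormedAddCommGroup X] [InnerProductSpace ℂ X]
  [NormedAddCommGroup Y] [InnerProductSpace ℂ Y] {c₀ C₀ : ℝ}

section Solution

/-- The constant in the sectoriality bound `‖z‖ ‖(z + A)⁻¹‖ ≤ 1 + |C₀| / c₀`. -/
noncomputable def sectorConst (c₀ C₀ : ℝ) : ℝ := 1 + |C₀| / c₀

theorem one_le_sectorConst (F : RegularForm X Y c₀ C₀) : 1 ≤ sectorConst c₀ C₀ := by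
  have := F.c₀_pos
  exact le_add_of_nonneg_right (by positivity)

/-- The energy estimates for the shifted form. Since `Re z ≥ 0`, the real part controls
`c₀ ‖u‖²`, and by boundedness of the form it also controls `|A(u, u)|`, hence `|z| ‖u‖²`. -/
theorem norm_solution_le (F : RegularForm X Y c₀ C₀) {z : ℂ} (hz : 0 ≤ z.re) {f : X} {u : Y}
    (hu : ∀ φ : Y, F.form u φ + z * ⟪F.ι φ, F.ι u⟫_ℂ = ⟪F.ι φ, f⟫_ℂ) :
    c₀ * ‖F.ι u‖ ≤ ‖f‖ ∧ ‖z‖ * ‖F.ι u‖ ≤ sectorConst c₀ C₀ * ‖f‖ := by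
  have hc := F.c₀_pos
  have h0 := hu u
  rw [inner_self_eq_norm_sq_to_K] at h0
  have h0' : F.form u u + z * ((‖F.ι u‖ ^ 2 : ℝ) : ℂ) = ⟪F.ι u, f⟫_ℂ := by
    rw [← h0]
    push_cast
    rfl
  have h1 := congrArg Complex.re h0'
  rw [Complex.add_re, Complex.re_mul_ofReal] at h1
  have h2 : ‖⟪F.ι u, f⟫_ℂ‖ ≤ ‖F.ι u‖ * ‖f‖ := norm_inner_le_norm _ _
  have h3 := Complex.re_le_norm ⟪F.ι u, f⟫_ℂ
  have h4 := F.coercive u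
  have h5 : ‖F.ι u‖ ^ 2 ≤ ‖u‖ ^ 2 := by
    have := F.norm_le u
    gcongr
  have h6 : 0 ≤ z.re * ‖F.ι u‖ ^ 2 := by positivity
  have h7 : c₀ * ‖F.ι u‖ ^ 2 ≤ c₀ * ‖u‖ ^ 2 := by gcongr
  have h8 : ‖F.form u u‖ ≤ |C₀| / c₀ * (‖F.ι u‖ * ‖f‖) := by
    have e1 : ‖F.form u u‖ ≤ |C₀| * ‖u‖ ^ 2 := by
      refine (F.bounded u u).trans ?_
      rw [mul_assoc, ← sq]
      gcongr
      exact le_abs_self _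
    have e2 : c₀ * ‖u‖ ^ 2 ≤ ‖F.ι u‖ * ‖f‖ := by linarith
    rw [div_mul_eq_mul_div, le_div_iff₀ hc]
    calc ‖F.form u u‖ * c₀ ≤ |C₀| * ‖u‖ ^ 2 * c₀ := by gcongr
      _ = |C₀| * (c₀ * ‖u‖ ^ 2) := by ring
      _ ≤ _ := by gcongr
  have h9 : ‖z‖ * ‖F.ι u‖ ^ 2 ≤ sectorConst c₀ C₀ * (‖F.ι u‖ * ‖f‖) := by
    have e : z * ((‖F.ι u‖ ^ 2 : ℝ) : ℂ) = ⟪F.ι u, f⟫_ℂ - F.form u u := by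
      rw [← h0']
      ring
    have := norm_sub_le ⟪F.ι u, f⟫_ℂ (F.form u u)
    rw [← e, norm_mul, Complex.norm_real, Real.norm_of_nonneg (by positivity)] at this
    rw [sectorConst]
    linarith
  rcases eq_or_lt_of_le (norm_nonneg (F.ι u)) with h | h
  · rw [← h]
    have := F.one_le_sectorConst
    simp only [mul_zero]
    exact ⟨norm_nonneg _, by positivity⟩
  · exact ⟨le_of_mul_le_mul_right (by nlinarith) h, le_of_mul_le_mul_right (by nlinarith) h⟩

variable [CompleteSpace X] [CompleteSpace Y]

theorem resolvent_eq_of_solution (F : RegularForm X Y c₀ C₀) {z : ℂ} (hz : 0 ≤ z.re) {f : X} {u : Y}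
    (hu : ∀ φ : Y, F.form u φ + z * ⟪F.ι φ, F.ι u⟫_ℂ = ⟪F.ι φ, f⟫_ℂ) :
    SincQuadrature.resolvent F.operator z f = F.ι u := by
  have h := (F.existsUnique_resolvent hz f).exists
  rw [SincQuadrature.resolvent, dif_pos h]
  obtain ⟨v, hv, hv'⟩ := (F.operator_shift_iff z _ f).1 ⟨h.choose, rfl, h.choose_spec⟩
  rw [← hv, (F.existsUnique_laxMilgram hz f).unique hv' hu]

theorem exists_solution (F : RegularForm X Y c₀ C₀) {z : ℂ} (hz : 0 ≤ z.re) (f : X) :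
    ∃ u : Y, SincQuadrature.resolvent F.operator z f = F.ι u ∧
      ∀ φ : Y, F.form u φ + z * ⟪F.ι φ, F.ι u⟫_ℂ = ⟪F.ι φ, f⟫_ℂ := by
  obtain ⟨u, hu, -⟩ := F.existsUnique_laxMilgram hz f
  exact ⟨u, F.resolvent_eq_of_solution hz hu, hu⟩

/-- The resolvent `(z + A)⁻¹`, for `0 ≤ Re z`, as a linear map. -/
noncomputable def resolventLinear (F : RegularForm X Y c₀ C₀) {z : ℂ} (hz : 0 ≤ z.re) :
    X →ₗ[ℂ] X where
  toFun := SincQuadrature.resolvent F.operator z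
  map_add' f g := by
    obtain ⟨u, hu, hu'⟩ := F.exists_solution hz f
    obtain ⟨v, hv, hv'⟩ := F.exists_solution hz g
    rw [hu, hv, ← map_add]
    refine F.resolvent_eq_of_solution hz fun φ => ?_
    rw [map_add, map_add, LinearMap.add_apply, inner_add_right, inner_add_right, ← hu', ← hv']
    ring
  map_smul' c f := by
    obtain ⟨u, hu, hu'⟩ := F.exists_solution hz f
    rw [hu, RingHom.id_apply, ← map_smul]
    refine F.resolvent_eq_of_solution hz fun φ => ?_
    rw [map_smul, map_smul, LinearMap.smul_apply, inner_smul_right, inner_smul_right, ← hu',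
      smul_eq_mul]
    ring

open Classical in
/-- The resolvent `(z + A)⁻¹` as a bounded operator, for `0 ≤ Re z` (and `0` elsewhere). -/
noncomputable def res (F : RegularForm X Y c₀ C₀) (z : ℂ) : X →L[ℂ] X :=
  if hz : 0 ≤ z.re then (F.resolventLinear hz).mkContinuous (1 / c₀) fun f => by
    obtain ⟨u, hu, hu'⟩ := F.exists_solution hz f
    have hc := F.c₀_pos
    change ‖SincQuadrature.resolvent F.operator z f‖ ≤ _
    rw [hu, div_mul_eq_mul_div, one_mul, le_div_iff₀ hc, mul_comm]
    exact (F.norm_solution_le hz hu').1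
  else 0

theorem res_apply (F : RegularForm X Y c₀ C₀) {z : ℂ} (hz : 0 ≤ z.re) (f : X) :
    F.res z f = SincQuadrature.resolvent F.operator z f := by
  rw [res, dif_pos hz]
  rfl

theorem norm_res_le (F : RegularForm X Y c₀ C₀) {z : ℂ} (hz : 0 ≤ z.re) : ‖F.res z‖ ≤ 1 / c₀ := by
  have hc := F.c₀_pos
  refine ContinuousLinearMap.opNorm_le_bound _ (by positivity) fun f => ?_
  obtain ⟨u, hu, hu'⟩ := F.exists_solution hz f
  rw [F.res_apply hz, hu, div_mul_eq_mul_div, one_mul, le_div_iff₀ hc, mul_comm]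
  exact (F.norm_solution_le hz hu').1

theorem norm_mul_norm_res_le (F : RegularForm X Y c₀ C₀) {z : ℂ} (hz : 0 ≤ z.re) :
    ‖z‖ * ‖F.res z‖ ≤ sectorConst c₀ C₀ := by
  have h1 := F.one_le_sectorConst
  rw [← norm_smul]
  refine ContinuousLinearMap.opNorm_le_bound _ (by positivity) fun f => ?_
  obtain ⟨u, hu, hu'⟩ := F.exists_solution hz f
  rw [smul_apply, norm_smul, F.res_apply hz, hu]
  exact (F.norm_solution_le hz hu').2

/-- The resolvent identity. -/
theorem res_sub_res (F : RegularForm X Y c₀ C₀) {z w : ℂ} (hz : 0 ≤ z.re) (hw : 0 ≤ w.re) :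
    F.res z - F.res w = (w - z) • (F.res z * F.res w) := by
  ext f
  obtain ⟨u, hu, hu'⟩ := F.exists_solution hz f
  obtain ⟨v, hv, hv'⟩ := F.exists_solution hw f
  have h : F.res z ((w - z) • F.ι v) = F.ι (u - v) := by
    rw [F.res_apply hz]
    refine F.resolvent_eq_of_solution hz fun φ => ?_
    have e1 := hu' φ
    have e2 := hv' φ
    rw [map_sub, map_sub, LinearMap.sub_apply, inner_sub_right, inner_smul_right]
    linear_combination e1 - e2
  rw [sub_apply, smul_apply, mul_apply_eq_comp, F.res_apply hw, hv,
    ← map_smul, h, F.res_apply hz, hu, map_sub]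

theorem res_commute (F : RegularForm X Y c₀ C₀) {z w : ℂ} (hz : 0 ≤ z.re) (hw : 0 ≤ w.re) :
    Commute (F.res z) (F.res w) := by
  rcases eq_or_ne z w with rfl | hne
  · exact Commute.refl _
  · have h3 : (w - z) • (F.res z * F.res w) = (w - z) • (F.res w * F.res z) := by
      rw [← F.res_sub_res hz hw, ← neg_sub (F.res w), F.res_sub_res hw hz, ← neg_smul, neg_sub]
    exact smul_right_injective _ (sub_ne_zero.2 hne.symm) h3

theorem continuousOn_res (F : RegularForm X Y c₀ C₀) : ContinuousOn F.res {z | 0 ≤ z.re} := by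
  have hc := F.c₀_pos
  have : LipschitzOnWith (1 / c₀ * (1 / c₀)).toNNReal F.res {z | 0 ≤ z.re} := by
    refine LipschitzOnWith.of_dist_le_mul fun z hz w hw => ?_
    rw [Real.coe_toNNReal _ (by positivity), dist_eq_norm, dist_eq_norm, F.res_sub_res hz hw,
      norm_smul, norm_sub_rev, mul_comm]
    gcongr
    exact (norm_mul_le _ _).trans
      (mul_le_mul (F.norm_res_le hz) (F.norm_res_le hw) (norm_nonneg _) (by positivity))
  exact this.continuousOn

/-- By the resolvent identity the difference quotients are `-R(w) R(z)`. -/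
theorem differentiableOn_res (F : RegularForm X Y c₀ C₀) :
    DifferentiableOn ℂ F.res {z | 0 < z.re} := by
  intro z hz
  have hz' : 0 < z.re := hz
  have hopen : {w : ℂ | 0 < w.re} ∈ nhds z :=
    (isOpen_lt continuous_const Complex.continuous_re).mem_nhds hz
  have hcont : ContinuousAt F.res z :=
    F.continuousOn_res.continuousAt (Filter.mem_of_superset hopen fun w (hw : 0 < w.re) => hw.le)
  have : HasDerivAt F.res (-(F.res z * F.res z)) z := by
    rw [hasDerivAt_iff_tendsto_slope]
    have hlim : Filter.Tendsto (fun w => -(F.res w * F.res z)) (nhdsWithin z {z}ᶜ)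
        (nhds (-(F.res z * F.res z))) :=
      ((hcont.mul continuousAt_const).neg.tendsto).mono_left nhdsWithin_le_nhds
    refine hlim.congr' ?_
    filter_upwards [nhdsWithin_le_nhds hopen, self_mem_nhdsWithin] with w hw hne
    have hne' : w - z ≠ 0 := sub_ne_zero.2 hne
    rw [slope_def_module, F.res_sub_res (le_of_lt hw) hz'.le, smul_smul, ← neg_sub w z, mul_neg,
      inv_mul_cancel₀ hne', neg_smul, one_smul]
  exact this.differentiableAt.differentiableWithinAt

theorem isResolventFamily (F : RegularForm X Y c₀ C₀) :
    IsResolventFamily fun μ : ℝ => F.res μ where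
  bounded := by
    refine ⟨max (1 / c₀) (sectorConst c₀ C₀), fun μ hμ => ?_⟩
    have hz : 0 ≤ (μ : ℂ).re := by simpa using hμ
    have h := F.norm_mul_norm_res_le hz
    rw [Complex.norm_real, Real.norm_of_nonneg hμ] at h
    exact ⟨(F.norm_res_le hz).trans (le_max_left _ _), h.trans (le_max_right _ _)⟩
  sub_eq μ ν hμ hν := by
    rw [F.res_sub_res (by simpa using hμ) (by simpa using hν), ← Complex.ofReal_sub]
    rfl

theorem res_zero_mem_domain (F : RegularForm X Y c₀ C₀) (g : X) :
    F.res 0 g ∈ F.operator.domain ∧ extend F.operator (F.res 0 g) = g := by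
  obtain ⟨u, hu, hu'⟩ := F.exists_solution (z := 0) le_rfl g
  obtain ⟨w, hw, hw'⟩ := (F.operator_shift_iff 0 (F.res 0 g) g).2
    ⟨u, by rw [F.res_apply le_rfl, hu], hu'⟩
  rw [zero_smul, zero_add] at hw'
  have hmem : F.res 0 g ∈ F.operator.domain := hw ▸ w.2
  refine ⟨hmem, ?_⟩
  rw [extend, dif_pos hmem, ← (Subtype.ext hw : w = ⟨F.res 0 g, hmem⟩), hw']

theorem res_zero_extend (F : RegularForm X Y c₀ C₀) {x : X} (hx : x ∈ F.operator.domain) :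
    F.res 0 (extend F.operator x) = x := by
  obtain ⟨u, hu, hu'⟩ := (F.operator_shift_iff 0 x (extend F.operator x)).1
    ⟨⟨x, hx⟩, rfl, by rw [zero_smul, zero_add, extend, dif_pos hx]⟩
  rw [F.res_apply le_rfl, F.resolvent_eq_of_solution le_rfl hu', hu]

/-- `Aⁿ A^{-n} = 1`. -/
theorem extend_iterate_res_zero_pow (F : RegularForm X Y c₀ C₀) (n : ℕ) (g : X) :
    (extend F.operator)^[n] ((F.res 0 ^ n) g) = g := by
  induction n with
  | zero => simp
  | succ n ih =>
    rw [Function.iterate_succ_apply, pow_succ', mul_apply_eq_comp,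
      (F.res_zero_mem_domain _).2, ih]

theorem res_zero_pow_mem_natDomain (F : RegularForm X Y c₀ C₀) (n : ℕ) (g : X) :
    (F.res 0 ^ n) g ∈ natDomain F.operator n := by
  intro j hj
  obtain ⟨m, rfl⟩ : ∃ m, n = j + (m + 1) := ⟨n - j - 1, by omega⟩
  rw [pow_add, mul_apply_eq_comp, extend_iterate_res_zero_pow, pow_succ',
    mul_apply_eq_comp]
  exact (F.res_zero_mem_domain _).1

theorem res_zero_pow_extend_iterate (F : RegularForm X Y c₀ C₀) (n : ℕ) {x : X}
    (hx : x ∈ natDomain F.operator n) : (F.res 0 ^ n) ((extend F.operator)^[n] x) = x := by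
  induction n generalizing x with
  | zero => simp
  | succ n ih =>
    rw [Function.iterate_succ_apply, pow_succ', mul_apply_eq_comp, ih]
    · exact F.res_zero_extend (hx 0 n.succ_pos)
    · intro j hj
      exact hx (j + 1) (by omega)

end Solution

section Powers

variable [CompleteSpace X] [CompleteSpace Y]

open Classical in
/-- The negative power `A^{-r}`, `r ≥ 0`, as a bounded operator: an integer power of `A⁻¹` times a
Balakrishnan integral for the fractional part of `r`. -/
noncomputable def negPower (F : RegularForm X Y c₀ C₀) (r : ℝ) : X →L[ℂ] X :=
  F.res 0 ^ ⌊r⌋₊ *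
    if Int.fract r = 0 then 1 else balakrishnan (fun μ : ℝ => F.res μ) (Int.fract r)

theorem negPower_nat (F : RegularForm X Y c₀ C₀) (n : ℕ) : F.negPower n = F.res 0 ^ n := by
  simp [negPower]

theorem negPower_of_mem_Ioo (F : RegularForm X Y c₀ C₀) {β : ℝ} (hβ : β ∈ Ioo (0 : ℝ) 1) :
    F.negPower β = balakrishnan (fun μ : ℝ => F.res μ) β := by
  have h : Int.fract β = β := Int.fract_eq_self.2 ⟨hβ.1.le, hβ.2⟩
  rw [negPower, h, if_neg hβ.1.ne', Nat.floor_eq_zero.2 hβ.2, pow_zero, one_mul]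

theorem negPow_eq_negPower (F : RegularForm X Y c₀ C₀) {β : ℝ} (hβ : β ∈ Ioo (0 : ℝ) 1) (f : X) :
    negPow F.operator β f = F.negPower β f := by
  rw [F.negPower_of_mem_Ioo hβ, balakrishnan, smul_apply, stieltjes,
    ContinuousLinearMap.integral_apply (F.isResolventFamily.integrableOn hβ), negPow,
    balakrishnanConst]
  congr 1
  refine setIntegral_congr_fun measurableSet_Ioi fun μ hμ => ?_
  simp only [smul_apply]
  rw [F.res_apply (by simpa using le_of_lt hμ)]

theorem commute_negPower (F : RegularForm X Y c₀ C₀) (r : ℝ) {x : X →L[ℂ] X}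
    (hx : ∀ μ : ℝ, 0 ≤ μ → Commute x (F.res μ)) : Commute x (F.negPower r) := by
  have h0 : Commute x (F.res 0) := by simpa using hx 0 le_rfl
  refine (h0.pow_right _).mul_right ?_
  split_ifs with h
  · exact Commute.one_right _
  · exact F.isResolventFamily.commute_balakrishnan
      ⟨lt_of_le_of_ne (Int.fract_nonneg r) (Ne.symm h), Int.fract_lt_one r⟩
      fun μ hμ => hx μ hμ.le

theorem res_commute_negPower (F : RegularForm X Y c₀ C₀) {z : ℂ} (hz : 0 ≤ z.re) (r : ℝ) :
    Commute (F.res z) (F.negPower r) :=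
  F.commute_negPower r fun μ hμ => F.res_commute hz (by simpa using hμ)

theorem negPower_commute_negPower (F : RegularForm X Y c₀ C₀) (r s : ℝ) :
    Commute (F.negPower r) (F.negPower s) :=
  F.commute_negPower s fun μ hμ => (F.res_commute_negPower (by simpa using hμ) r).symm

theorem negPower_add_of_lt_one (F : RegularForm X Y c₀ C₀) {α β : ℝ} (hα : α ∈ Ico (0 : ℝ) 1)
    (hβ : β ∈ Ico (0 : ℝ) 1) : F.negPower (α + β) = F.negPower α * F.negPower β := by
  have p0 : F.negPower 0 = 1 := by simpa using F.negPower_nat 0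
  rcases eq_or_lt_of_le hα.1 with rfl | hα0
  · rw [zero_add, p0, one_mul]
  rcases eq_or_lt_of_le hβ.1 with rfl | hβ0
  · rw [add_zero, p0, mul_one]
  rw [F.negPower_of_mem_Ioo ⟨hα0, hα.2⟩, F.negPower_of_mem_Ioo ⟨hβ0, hβ.2⟩]
  have hR := F.isResolventFamily
  rcases lt_trichotomy (α + β) 1 with h | h | h
  · rw [F.negPower_of_mem_Ioo ⟨by positivity, h⟩, hR.balakrishnan_mul_of_add_lt_one hα0 hβ0 h]
  · rw [h, hR.balakrishnan_mul_of_add_eq_one hα0 hβ0 h]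
    simpa using F.negPower_nat 1
  · rw [hR.balakrishnan_mul_of_one_lt_add hα.2 hβ.2 h]
    have h2 : α + β < 2 := by linarith [hα.2, hβ.2]
    have hf : ⌊α + β⌋ = 1 := Int.floor_eq_iff.2 ⟨by push_cast; linarith, by push_cast; linarith⟩
    have hn : ⌊α + β⌋₊ = 1 := (Nat.floor_eq_iff (by linarith)).2
      ⟨by push_cast; linarith, by push_cast; linarith⟩
    have hfr : Int.fract (α + β) = α + β - 1 := by rw [Int.fract, hf, Int.cast_one]
    rw [negPower, hfr, hn, pow_one, if_neg (by linarith)]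
    simp

theorem negPower_nat_add (F : RegularForm X Y c₀ C₀) (n : ℕ) {r : ℝ} (hr : 0 ≤ r) :
    F.negPower (n + r) = F.res 0 ^ n * F.negPower r := by
  rw [negPower, negPower, Int.fract_natCast_add, add_comm (n : ℝ), Nat.floor_add_natCast hr,
    add_comm, pow_add, mul_assoc]

/-- The semigroup law `A^{-(r + s)} = A^{-r} A^{-s}`. -/
theorem negPower_add (F : RegularForm X Y c₀ C₀) {r s : ℝ} (hr : 0 ≤ r) (hs : 0 ≤ s) :
    F.negPower (r + s) = F.negPower r * F.negPower s := by
  have key : ∀ {r : ℝ}, 0 ≤ r → r = ⌊r⌋₊ + Int.fract r := fun {r} hr => by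
    rw [natCast_floor_eq_intCast_floor hr, Int.floor_add_fract]
  have hfr : ∀ r : ℝ, Int.fract r ∈ Ico (0 : ℝ) 1 :=
    fun r => ⟨Int.fract_nonneg r, Int.fract_lt_one r⟩
  have e : r + s = ((⌊r⌋₊ + ⌊s⌋₊ : ℕ) : ℝ) + (Int.fract r + Int.fract s) := by
    conv_lhs => rw [key hr, key hs]
    push_cast
    ring
  have er := F.negPower_nat_add ⌊r⌋₊ (hfr r).1
  have es := F.negPower_nat_add ⌊s⌋₊ (hfr s).1
  rw [← key hr] at er
  rw [← key hs] at es
  rw [e, F.negPower_nat_add _ (add_nonneg (hfr r).1 (hfr s).1),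
    F.negPower_add_of_lt_one (hfr r) (hfr s), er, es, pow_add]
  have hc : Commute (F.res 0 ^ ⌊s⌋₊) (F.negPower (Int.fract r)) :=
    (F.res_commute_negPower le_rfl _).pow_left _
  simp only [mul_assoc]
  rw [← mul_assoc (F.res 0 ^ ⌊s⌋₊) (F.negPower (Int.fract r)), hc.eq]
  simp only [mul_assoc]

/-- `A^{-r}` is a factor of the injective operator `A^{-n}`, `n = ⌈r⌉`. -/
theorem negPower_injective (F : RegularForm X Y c₀ C₀) {r : ℝ} (hr : 0 ≤ r) :
    Function.Injective (F.negPower r) := by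
  have h := F.negPower_add (sub_nonneg.2 (Nat.le_ceil r)) hr
  rw [sub_add_cancel, negPower_nat] at h
  have hinj : Function.Injective (F.res 0 ^ ⌈r⌉₊) :=
    Function.LeftInverse.injective (F.extend_iterate_res_zero_pow ⌈r⌉₊)
  rw [h] at hinj
  exact Function.Injective.of_comp (f := F.negPower (⌈r⌉₊ - r)) hinj

/-- The two cases in the definition of `fracPart` are both `A^{-(n - r)}`, `n = ⌈r⌉`. -/
theorem fracPart_eq (F : RegularForm X Y c₀ C₀) {r : ℝ} (hr : 0 ≤ r) (x : X) :
    fracPart F.operator r x = F.negPower (⌈r⌉₊ - r) x := by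
  rw [fracPart]
  split_ifs with h
  · have p0 : F.negPower 0 = 1 := by simpa using F.negPower_nat 0
    rw [h, sub_self, p0]
    rfl
  · refine F.negPow_eq_negPower ⟨sub_pos.2 (lt_of_le_of_ne (Nat.le_ceil r) (Ne.symm h)), ?_⟩ x
    linarith [Nat.ceil_lt_add_one hr]

theorem fracPart_negPower (F : RegularForm X Y c₀ C₀) {r : ℝ} (hr : 0 ≤ r) (g : X) :
    fracPart F.operator r (F.negPower r g) = (F.res 0 ^ ⌈r⌉₊) g := by
  have h := F.negPower_add (sub_nonneg.2 (Nat.le_ceil r)) hr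
  rw [sub_add_cancel, negPower_nat] at h
  rw [F.fracPart_eq hr, h, mul_apply_eq_comp]

theorem negPower_mem_fracDomain (F : RegularForm X Y c₀ C₀) {r : ℝ} (hr : 0 ≤ r) (g : X) :
    F.negPower r g ∈ fracDomain F.operator r := by
  change fracPart F.operator r (F.negPower r g) ∈ natDomain F.operator ⌈r⌉₊
  rw [F.fracPart_negPower hr]
  exact F.res_zero_pow_mem_natDomain _ _

theorem fracPow_negPower (F : RegularForm X Y c₀ C₀) {r : ℝ} (hr : 0 ≤ r) (g : X) :
    fracPow F.operator r (F.negPower r g) = g := by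
  rw [fracPow, F.fracPart_negPower hr, extend_iterate_res_zero_pow]

/-- Together with `negPower_mem_fracDomain` this says that `D(A^r)` is the range of `A^{-r}`. -/
theorem negPower_fracPow (F : RegularForm X Y c₀ C₀) {r : ℝ} (hr : 0 ≤ r) {x : X}
    (hx : x ∈ fracDomain F.operator r) : F.negPower r (fracPow F.operator r x) = x := by
  have h1 : (F.res 0 ^ ⌈r⌉₊) (fracPow F.operator r x) = fracPart F.operator r x :=
    F.res_zero_pow_extend_iterate _ hx
  have h := F.negPower_add (sub_nonneg.2 (Nat.le_ceil r)) hr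
  rw [sub_add_cancel, negPower_nat] at h
  rw [h, F.fracPart_eq hr, mul_apply_eq_comp] at h1
  exact F.negPower_injective (sub_nonneg.2 (Nat.le_ceil r)) h1

end Powers

end RegularForm

/-! ### Smoothing estimates and the quadrature error -/

namespace RegularForm

variable {X Y : Type*} [NormedAddCommGroup X] [InnerProductSpace ℂ X]
  [NormedAddCommGroup Y] [InnerProductSpace ℂ Y] {c₀ C₀ : ℝ}
  [CompleteSpace X] [CompleteSpace Y]

/-- An upper bound for `‖A^{-r}‖` in terms of the constants of the form. If `r` is an integer, then
`1 / Int.fract r` is the junk value `0`, and the second factor is still at least one. -/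
noncomputable def negPowerBound (c₀ C₀ r : ℝ) : ℝ :=
  (1 / c₀) ^ ⌊r⌋₊ * (1 + max (1 / c₀) (sectorConst c₀ C₀) *
    (1 / (1 - Int.fract r) + 1 / Int.fract r))

theorem norm_negPower_le (F : RegularForm X Y c₀ C₀) (r : ℝ) :
    ‖F.negPower r‖ ≤ negPowerBound c₀ C₀ r := by
  have hc := F.c₀_pos
  have hK := F.one_le_sectorConst
  have hf0 := Int.fract_nonneg r
  have hf1 := sub_pos.2 (Int.fract_lt_one r)
  have h1 : ‖(1 : X →L[ℂ] X)‖ ≤ 1 := ContinuousLinearMap.norm_id_le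
  have hT : ‖F.res 0 ^ ⌊r⌋₊‖ ≤ (1 / c₀) ^ ⌊r⌋₊ := by
    rcases Nat.eq_zero_or_pos ⌊r⌋₊ with h | h
    · rw [h, pow_zero, pow_zero]
      exact h1
    · refine (norm_pow_le' _ h).trans ?_
      gcongr
      exact F.norm_res_le le_rfl
  rw [negPower, negPowerBound]
  refine (norm_mul_le _ _).trans (mul_le_mul hT ?_ (norm_nonneg _) (by positivity))
  split_ifs with h
  · refine h1.trans (le_add_of_nonneg_right ?_)
    positivity
  · have hfr : Int.fract r ∈ Ioo (0 : ℝ) 1 :=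
      ⟨lt_of_le_of_ne hf0 (Ne.symm h), Int.fract_lt_one r⟩
    refine (norm_balakrishnanConst_smul_le hfr _).trans ?_
    refine ((integrableOn_rpow_smul_and_norm_integral_le
      (K := max (1 / c₀) (sectorConst c₀ C₀))
      (F.isResolventFamily.continuousOn.mono Ioi_subset_Ici_self) one_pos hfr
      (fun μ hμ => ?_) fun μ hμ => ?_).2).trans ?_
    · rw [div_one]
      exact (F.norm_res_le (by simpa using le_of_lt hμ)).trans (le_max_left _ _)
    · have h := F.norm_mul_norm_res_le (z := μ) (by simpa using le_of_lt hμ)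
      rw [Complex.norm_real, Real.norm_of_nonneg (le_of_lt hμ)] at h
      rw [le_div_iff₀ hμ, mul_comm]
      exact h.trans (le_max_right _ _)
    · rw [Real.one_rpow, mul_one]
      exact le_add_of_nonneg_left zero_le_one

/-- The bounded operator `A (z + A)⁻¹ = 1 - z (z + A)⁻¹`. -/
noncomputable def yosida (F : RegularForm X Y c₀ C₀) (z : ℂ) : X →L[ℂ] X :=
  1 - z • F.res z

theorem norm_yosida_le (F : RegularForm X Y c₀ C₀) {z : ℂ} (hz : 0 ≤ z.re) :
    ‖F.yosida z‖ ≤ 1 + sectorConst c₀ C₀ := by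
  refine (norm_sub_le _ _).trans (add_le_add ContinuousLinearMap.norm_id_le ?_)
  rw [norm_smul]
  exact F.norm_mul_norm_res_le hz

theorem yosida_mul_res (F : RegularForm X Y c₀ C₀) {z w : ℂ} (hz : 0 ≤ z.re) (hw : 0 ≤ w.re) :
    F.yosida z * F.res w = F.res z * F.yosida w := by
  have h := F.res_sub_res hz hw
  rw [yosida, yosida, sub_mul, mul_sub, one_mul, mul_one, smul_mul_assoc, mul_smul_comm]
  rw [sub_smul] at h
  rw [sub_eq_sub_iff_add_eq_add]
  rw [sub_eq_sub_iff_add_eq_add] at h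
  rw [add_comm, add_comm (F.res z)] at *
  exact h.symm

theorem yosida_mul_res_zero (F : RegularForm X Y c₀ C₀) {z : ℂ} (hz : 0 ≤ z.re) :
    F.yosida z * F.res 0 = F.res z := by
  rw [F.yosida_mul_res hz le_rfl, yosida, zero_smul, sub_zero, mul_one]

/-- The bounded operator `A^s (z + A)⁻¹ = A (z + A)⁻¹ A^{s - 1}`, for `0 ≤ s < 1`. -/
noncomputable def smoothed (F : RegularForm X Y c₀ C₀) (s : ℝ) (z : ℂ) : X →L[ℂ] X :=
  F.yosida z * F.negPower (1 - s)

theorem negPower_mul_smoothed (F : RegularForm X Y c₀ C₀) {s : ℝ} (hs : s ∈ Ico (0 : ℝ) 1) {z : ℂ}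
    (hz : 0 ≤ z.re) : F.negPower s * F.smoothed s z = F.res z := by
  have h1 : Commute (F.negPower s) (F.yosida z) :=
    (Commute.one_right _).sub_right ((F.res_commute_negPower hz s).symm.smul_right z)
  have h2 : F.negPower s * F.negPower (1 - s) = F.res 0 := by
    rw [← F.negPower_add hs.1 (by linarith [hs.2]), add_sub_cancel]
    simpa using F.negPower_nat 1
  rw [smoothed, ← mul_assoc, h1.eq, mul_assoc, h2, F.yosida_mul_res_zero hz]

/-- The constant in the bound `‖A^s (z + A)⁻¹‖ ≤ C |z|^{s - 1}`, for `0 ≤ s < 1`. The first summand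
serves the case `s = 0`, where `1 / s` is the junk value `0`. -/
noncomputable def smoothingConst (c₀ C₀ s : ℝ) : ℝ :=
  sectorConst c₀ C₀ + (1 + sectorConst c₀ C₀) * sectorConst c₀ C₀ * (1 / s + 1 / (1 - s))

/-- The operator `A (z + A)⁻¹ (μ + A)⁻¹` is bounded by a multiple of both `1 / μ` and `1 / ρ`, for
`ρ = c₀` and for `ρ = |z|`; the Balakrishnan integral turns this into the power `ρ^{s - 1}`. -/
theorem norm_smoothed_le (F : RegularForm X Y c₀ C₀) {s : ℝ} (hs : s ∈ Ico (0 : ℝ) 1) {z : ℂ}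
    (hz : 0 ≤ z.re) {ρ : ℝ} (hρ : 0 < ρ) (hρz : ρ = c₀ ∨ ρ = ‖z‖) :
    ‖F.smoothed s z‖ ≤ smoothingConst c₀ C₀ s * ρ ^ (s - 1) := by
  have hK := F.one_le_sectorConst
  have hK0 : 0 < sectorConst c₀ C₀ := by linarith
  have h1s : 0 < 1 - s := by linarith [hs.2]
  have hs0 := hs.1
  have hyo := F.norm_yosida_le hz
  rcases eq_or_lt_of_le hs0 with rfl | hs0'
  · have e : F.smoothed 0 z = F.res z := by
      have h := F.negPower_nat 1
      rw [Nat.cast_one, pow_one] at h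
      rw [smoothed, sub_zero, h, F.yosida_mul_res_zero hz]
    have hres : ‖F.res z‖ ≤ sectorConst c₀ C₀ * ρ⁻¹ := by
      rcases hρz with rfl | rfl
      · refine (F.norm_res_le hz).trans ?_
        rw [one_div]
        exact le_mul_of_one_le_left (by positivity) hK
      · rw [← div_eq_mul_inv, le_div_iff₀ hρ, mul_comm]
        exact F.norm_mul_norm_res_le hz
    rw [e, zero_sub, Real.rpow_neg_one]
    refine hres.trans (mul_le_mul_of_nonneg_right ?_ (by positivity))
    rw [smoothingConst]
    exact le_add_of_nonneg_right (by positivity)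
  · have hs' : 1 - s ∈ Ioo (0 : ℝ) 1 := ⟨h1s, by linarith⟩
    have hi := F.isResolventFamily.integrableOn hs'
    have hcont : ContinuousOn (fun μ : ℝ => F.yosida z * F.res μ) (Ioi 0) :=
      continuousOn_const.mul (F.isResolventFamily.continuousOn.mono Ioi_subset_Ici_self)
    have e : F.smoothed s z = balakrishnanConst (1 - s) •
        ∫ μ in Ioi (0 : ℝ), μ ^ (-(1 - s)) • (F.yosida z * F.res μ) := by
      rw [smoothed, F.negPower_of_mem_Ioo hs', balakrishnan, mul_smul_comm, stieltjes,
        ← integral_const_mul_of_integrable hi]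
      simp only [mul_smul_comm]
    rw [e]
    refine (norm_balakrishnanConst_smul_le hs' _).trans ?_
    refine ((integrableOn_rpow_smul_and_norm_integral_le
      (K := (1 + sectorConst c₀ C₀) * sectorConst c₀ C₀) hcont hρ hs'
      (fun μ hμ => ?_) fun μ hμ => ?_).2).trans ?_
    · have hμ' : 0 ≤ (μ : ℂ).re := by simpa using le_of_lt hμ
      rcases hρz with rfl | rfl
      · refine (norm_mul_le _ _).trans ?_
        rw [mul_div_assoc]
        refine mul_le_mul hyo ((F.norm_res_le hμ').trans ?_) (norm_nonneg _) (by positivity)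
        gcongr
      · rw [F.yosida_mul_res hz hμ', mul_comm (1 + _), mul_div_right_comm]
        refine (norm_mul_le _ _).trans
          (mul_le_mul ?_ (F.norm_yosida_le hμ') (norm_nonneg _) (by positivity))
        rw [le_div_iff₀ hρ, mul_comm]
        exact F.norm_mul_norm_res_le hz
    · have hμ0 : 0 < μ := hμ
      have hμ' : 0 ≤ (μ : ℂ).re := by simpa using le_of_lt hμ
      refine (norm_mul_le _ _).trans ?_
      rw [mul_div_assoc]
      refine mul_le_mul hyo ?_ (norm_nonneg _) (by positivity)
      have h := F.norm_mul_norm_res_le hμ'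
      rw [Complex.norm_real, Real.norm_of_nonneg hμ0.le] at h
      rw [le_div_iff₀ hμ0, mul_comm]
      exact h
    · have hexp : -(1 - s) = s - 1 := by ring
      rw [sub_sub_cancel, hexp, mul_right_comm]
      refine mul_le_mul_of_nonneg_right ?_ (by positivity)
      rw [smoothingConst]
      exact le_add_of_nonneg_left hK0.le

/-- The integrand of `A^s A^{-β}` after the substitution `μ = e^w`. -/
noncomputable def sincIntegrand (F : RegularForm X Y c₀ C₀) (β s : ℝ) (w : ℂ) : X →L[ℂ] X :=
  Complex.exp ((1 - β) * w) • F.smoothed s (Complex.exp w)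

theorem isStripDecaying_sincIntegrand (F : RegularForm X Y c₀ C₀) (β : ℝ) {s : ℝ}
    (hs : s ∈ Ico (0 : ℝ) 1) :
    IsStripDecaying (F.sincIntegrand β s) (smoothingConst c₀ C₀ s * max 1 (c₀ ^ (s - 1)))
      (1 - β) (β - s) := by
  have hc := F.c₀_pos
  have hK := F.one_le_sectorConst
  have h1s : 0 < 1 - s := by linarith [hs.2]
  have hs0 := hs.1
  have hsm : 0 ≤ smoothingConst c₀ C₀ s := by
    rw [smoothingConst]
    positivity
  have hre : ∀ w : ℂ, |w.im| ≤ Real.pi / 2 → 0 ≤ (Complex.exp w).re := by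
    intro w hw
    rw [Complex.exp_re]
    exact mul_nonneg (Real.exp_pos _).le
      (Real.cos_nonneg_of_neg_pi_div_two_le_of_le (abs_le.1 hw).1 (abs_le.1 hw).2)
  have hre' : ∀ w : ℂ, |w.im| < Real.pi / 2 → 0 < (Complex.exp w).re := by
    intro w hw
    rw [Complex.exp_re]
    exact mul_pos (Real.exp_pos _) (Real.cos_pos_of_mem_Ioo (abs_lt.1 hw))
  have hnorm : ∀ w : ℂ, ‖Complex.exp ((1 - β) * w)‖ = Real.exp ((1 - β) * w.re) := by
    intro w
    rw [Complex.norm_exp]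
    simp [Complex.mul_re]
  refine ⟨?_, ?_, fun w hw => ?_, fun w hw => ?_⟩
  · have h₁ : Continuous fun w : ℂ => Complex.exp ((1 - β) * w) := by fun_prop
    have h₂ : ContinuousOn (fun w : ℂ => F.res (Complex.exp w)) {w | |w.im| ≤ Real.pi / 2} :=
      F.continuousOn_res.comp Complex.continuous_exp.continuousOn fun w hw => hre w hw
    exact h₁.continuousOn.smul ((continuousOn_const.sub
      (Complex.continuous_exp.continuousOn.smul h₂)).mul continuousOn_const)
  · have h₁ : Differentiable ℂ fun w : ℂ => Complex.exp ((1 - β) * w) := by fun_prop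
    have h₂ : DifferentiableOn ℂ (fun w : ℂ => F.res (Complex.exp w))
        {w | |w.im| < Real.pi / 2} :=
      F.differentiableOn_res.comp Complex.differentiable_exp.differentiableOn
        fun w hw => hre' w hw
    exact h₁.differentiableOn.smul (((differentiableOn_const _).sub
      (Complex.differentiable_exp.differentiableOn.smul h₂)).mul (differentiableOn_const _))
  · rw [sincIntegrand, norm_smul, hnorm, mul_comm]
    refine mul_le_mul_of_nonneg_right ?_ (Real.exp_pos _).le
    exact (F.norm_smoothed_le hs (hre w hw) hc (Or.inl rfl)).trans
      (mul_le_mul_of_nonneg_left (le_max_right _ _) hsm)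
  · rw [sincIntegrand, norm_smul, hnorm]
    have h := F.norm_smoothed_le hs (hre w hw) (norm_pos_iff.2 (Complex.exp_ne_zero w))
      (Or.inr rfl)
    have e : Real.exp ((1 - β) * w.re) * ‖Complex.exp w‖ ^ (s - 1)
        = Real.exp (-(β - s) * w.re) := by
      rw [Complex.norm_exp, ← Real.exp_mul, ← Real.exp_add]
      congr 1
      ring
    calc _ ≤ Real.exp ((1 - β) * w.re)
          * (smoothingConst c₀ C₀ s * ‖Complex.exp w‖ ^ (s - 1)) := by gcongr
      _ = smoothingConst c₀ C₀ s * Real.exp (-(β - s) * w.re) := by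
        rw [← e]
        ring
      _ ≤ _ := by
        gcongr
        exact le_mul_of_one_le_right hsm (le_max_left _ _)

/-- The truncated sinc quadrature as a bounded operator. -/
noncomputable def sincQuadCLM (F : RegularForm X Y c₀ C₀) (β k : ℝ) (M N : ℕ) : X →L[ℂ] X :=
  (k * balakrishnanConst β) • ∑ l ∈ Finset.Icc (-(M : ℤ)) N,
    Real.exp ((1 - β) * (l * k)) • F.res (Real.exp (l * k) : ℝ)

theorem sincQuad_eq (F : RegularForm X Y c₀ C₀) (β k : ℝ) (M N : ℕ) (f : X) :
    sincQuad F.operator β k M N f = F.sincQuadCLM β k M N f := by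
  rw [sincQuad, sincQuadCLM, smul_apply, sum_apply, balakrishnanConst, mul_div_assoc]
  congr 1
  refine Finset.sum_congr rfl fun l _ => ?_
  rw [smul_apply, F.res_apply (by rw [Complex.ofReal_re]; positivity)]

theorem commute_sincQuadCLM (F : RegularForm X Y c₀ C₀) (β k : ℝ) (M N : ℕ) (r : ℝ) :
    Commute (F.negPower r) (F.sincQuadCLM β k M N) := by
  refine (Commute.sum_right _ _ _ fun l _ => ?_).smul_right _
  exact (F.res_commute_negPower (by rw [Complex.ofReal_re]; positivity) r).symm.smul_right _

/-- `A^s (A^{-β} - Q)` is a bounded operator whose norm is bounded by the sinc quadrature error. -/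
theorem exists_negPower_mul_eq_sub (F : RegularForm X Y c₀ C₀) {β s : ℝ} (hβ : β ∈ Ioo (0 : ℝ) 1)
    (hs0 : 0 ≤ s) (hs : s < β) {k : ℝ} (hk : 0 < k) (M N : ℕ) :
    ∃ H : X →L[ℂ] X, F.negPower s * H = F.negPower β - F.sincQuadCLM β k M N ∧
      ‖H‖ ≤ smoothingConst c₀ C₀ s * max 1 (c₀ ^ (s - 1)) * (1 / (1 - β) + 1 / (β - s)) *
        ((Real.sinh (Real.pi ^ 2 / (2 * k)))⁻¹ * Real.exp (-(Real.pi ^ 2 / (2 * k)))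
          + Real.exp (-((β - s) * N * k)) + Real.exp (-((1 - β) * M * k))) := by
  have hs1 : s ∈ Ico (0 : ℝ) 1 := ⟨hs0, hs.trans hβ.2⟩
  have hdec := F.isStripDecaying_sincIntegrand β hs1
  have ha : 0 < 1 - β := sub_pos.2 hβ.2
  have hb : 0 < β - s := sub_pos.2 hs
  have hpt : ∀ x : ℝ, F.negPower s * F.sincIntegrand β s x
      = Real.exp ((1 - β) * x) • F.res (Real.exp x : ℝ) := by
    intro x
    have hx : 0 ≤ (Complex.exp x).re := by
      rw [← Complex.ofReal_exp, Complex.ofReal_re]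
      exact (Real.exp_pos x).le
    rw [sincIntegrand, mul_smul_comm, F.negPower_mul_smoothed hs1 hx, Complex.ofReal_exp,
      ← Complex.coe_smul, Complex.ofReal_exp]
    push_cast
    rfl
  have hi : Integrable fun x : ℝ => F.sincIntegrand β s x := by
    simpa using (hdec.integrable_and_integral_norm_le ha hb (c := 0)
      (by simpa using by positivity)).1
  refine ⟨balakrishnanConst β • ((∫ x : ℝ, F.sincIntegrand β s x)
    - k • ∑ l ∈ Finset.Icc (-(M : ℤ)) N, F.sincIntegrand β s ((l * k : ℝ))), ?_, ?_⟩
  · rw [mul_smul_comm, mul_sub, ← integral_const_mul_of_integrable hi, mul_smul_comm,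
      Finset.mul_sum, smul_sub, F.negPower_of_mem_Ioo hβ, balakrishnan, stieltjes,
      integral_Ioi_eq_integral_exp_smul, sincQuadCLM, smul_smul, mul_comm k]
    congr 2
    · refine integral_congr_ae (Filter.Eventually.of_forall fun x => ?_)
      simp only
      rw [hpt, smul_smul, ← Real.exp_mul, ← Real.exp_add]
      congr 2
      ring
    · exact Finset.sum_congr rfl fun l _ => hpt _
  · exact (norm_balakrishnanConst_smul_le hβ _).trans
      (hdec.norm_integral_sub_sum_le ha hb hk M N)

/-- The error estimate for the truncated sinc quadrature. With `s⁻ = max 0 (-s)`,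
`(A^{-β} - Q) A^{-t} g = A^{-(s + t)} A^{-s⁻} H g`, where `A^{-s⁺} H = A^{-β} - Q`. -/
theorem sincQuad_error (F : RegularForm X Y c₀ C₀) {β s t : ℝ} (hβ : β ∈ Ioo (0 : ℝ) 1)
    (hs : s < β) (ht : 0 ≤ t) (hst : -t ≤ s) {f : X} (hf : f ∈ fracDomain F.operator t) {k : ℝ}
    (hk : 0 < k) (M N : ℕ) :
    negPow F.operator β f - sincQuad F.operator β k M N f ∈ fracDomain F.operator (s + t) ∧
    fracNorm F.operator (s + t) (negPow F.operator β f - sincQuad F.operator β k M N f)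
      ≤ negPowerBound c₀ C₀ (max 0 (-s)) *
        (smoothingConst c₀ C₀ (max 0 s) * max 1 (c₀ ^ (max 0 s - 1)) *
          (1 / (1 - β) + 1 / (β - max 0 s)))
        * ((Real.sinh (Real.pi ^ 2 / (2 * k)))⁻¹ * Real.exp (-(Real.pi ^ 2 / (2 * k)))
          + Real.exp (-((β - max 0 s) * N * k)) + Real.exp (-((1 - β) * M * k)))
        * fracNorm F.operator t f := by
  obtain ⟨H, hH, hHle⟩ := F.exists_negPower_mul_eq_sub hβ (le_max_left 0 s)
    (max_lt hβ.1 hs) hk M N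
  have hst' : 0 ≤ s + t := by linarith
  -- `t + s⁺ = (s + t) + s⁻`
  have hsplit : t + max 0 s = s + t + max 0 (-s) := by
    rcases le_total 0 s with h | h
    · rw [max_eq_right h, max_eq_left (by linarith)]; ring
    · rw [max_eq_left h, max_eq_right (by linarith)]; ring
  set g := fracPow F.operator t f with hg
  have hfg : F.negPower t g = f := F.negPower_fracPow ht hf
  have hcomm : Commute (F.negPower t) (F.negPower β - F.sincQuadCLM β k M N) :=
    (F.negPower_commute_negPower t β).sub_right (F.commute_sincQuadCLM β k M N t)
  have hop : (F.negPower β - F.sincQuadCLM β k M N) * F.negPower t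
      = F.negPower (s + t) * (F.negPower (max 0 (-s)) * H) := by
    rw [← hcomm.eq, ← hH, ← mul_assoc, ← mul_assoc, ← F.negPower_add ht (le_max_left _ _),
      ← F.negPower_add hst' (le_max_left _ _), hsplit]
  have herr : negPow F.operator β f - sincQuad F.operator β k M N f
      = F.negPower (s + t) (F.negPower (max 0 (-s)) (H g)) := by
    rw [F.negPow_eq_negPower hβ, F.sincQuad_eq, ← sub_apply, ← hfg, ← mul_apply_eq_comp, hop,
      mul_apply_eq_comp, mul_apply_eq_comp]
  rw [herr]
  refine ⟨F.negPower_mem_fracDomain hst' _, ?_⟩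
  rw [fracNorm, F.fracPow_negPower hst', fracNorm, ← hg]
  have h1 := F.norm_negPower_le (max 0 (-s))
  calc ‖F.negPower (max 0 (-s)) (H g)‖
      ≤ ‖F.negPower (max 0 (-s))‖ * (‖H‖ * ‖g‖) :=
        (ContinuousLinearMap.le_opNorm _ _).trans
          (mul_le_mul_of_nonneg_left (H.le_opNorm g) (norm_nonneg _))
    _ ≤ negPowerBound c₀ C₀ (max 0 (-s)) * (_ * ‖g‖) :=
        mul_le_mul h1 (mul_le_mul_of_nonneg_right hHle (norm_nonneg _)) (by positivity)
          ((norm_nonneg _).trans h1)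
    _ = _ := by ring

end RegularForm

end SincQuadrature

theorem theorem3p1 (β s c₀ C₀ : ℝ) (hβ : β ∈ Set.Ioo (0 : ℝ) 1) (hs : s < β) :
    ∃ C : ℝ, 0 < C ∧
      ∀ (X Y : Type*) [NormedAddCommGroup X] [InnerProductSpace ℂ X] [CompleteSpace X]
        [NormedAddCommGroup Y] [InnerProductSpace ℂ Y] [CompleteSpace Y]
        (F : SincQuadrature.RegularForm X Y c₀ C₀) (t : ℝ), 0 ≤ t → -t ≤ s →
      ∀ f ∈ SincQuadrature.fracDomain F.operator t, ∀ k : ℝ, 0 < k →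
        (∀ M N : ℕ, 0 < M → 0 < N →
          SincQuadrature.negPow F.operator β f - SincQuadrature.sincQuad F.operator β k M N f
              ∈ SincQuadrature.fracDomain F.operator (s + t) ∧
          SincQuadrature.fracNorm F.operator (s + t)
              (SincQuadrature.negPow F.operator β f
                - SincQuadrature.sincQuad F.operator β k M N f)
            ≤ C * ((Real.sinh (Real.pi ^ 2 / (2 * k)))⁻¹ * Real.exp (-(Real.pi ^ 2 / (2 * k)))
                + Real.exp (-((β - max 0 s) * N * k)) + Real.exp (-((1 - β) * M * k)))
              * SincQuadrature.fracNorm F.operator t f) ∧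
        ∀ M N : ℕ, M = ⌈Real.pi ^ 2 / (2 * (1 - β) * k ^ 2)⌉₊ →
          N = ⌈Real.pi ^ 2 / (2 * (β - max 0 s) * k ^ 2)⌉₊ →
          SincQuadrature.fracNorm F.operator (s + t)
              (SincQuadrature.negPow F.operator β f
                - SincQuadrature.sincQuad F.operator β k M N f)
            ≤ C * (1 / (β - max 0 s) + 1 / (1 - β))
              * ((Real.sinh (Real.pi ^ 2 / (2 * k)))⁻¹ * Real.exp (-(Real.pi ^ 2 / (2 * k)))
                + Real.exp (-(Real.pi ^ 2 / (2 * k))))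
              * SincQuadrature.fracNorm F.operator t f := by
  set C := SincQuadrature.RegularForm.negPowerBound c₀ C₀ (max 0 (-s)) *
    (SincQuadrature.RegularForm.smoothingConst c₀ C₀ (max 0 s) * max 1 (c₀ ^ (max 0 s - 1)) *
      (1 / (1 - β) + 1 / (β - max 0 s))) with hC
  refine ⟨max 1 C, lt_max_of_lt_left one_pos, ?_⟩
  intro X Y _ _ _ _ _ _ F t ht hst f hf k hk
  have hM : 0 < 1 - β := sub_pos.2 hβ.2
  have hN : 0 < β - max 0 s := sub_pos.2 (max_lt hβ.1 hs)
  have hsinh : 0 < Real.sinh (Real.pi ^ 2 / (2 * k)) := Real.sinh_pos_iff.2 (by positivity)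
  have hfn : 0 ≤ SincQuadrature.fracNorm F.operator t f := norm_nonneg _
  have hmain := fun M N : ℕ => F.sincQuad_error hβ hs ht hst hf hk M N
  have hmax : ∀ M N : ℕ, SincQuadrature.fracNorm F.operator (s + t)
      (SincQuadrature.negPow F.operator β f - SincQuadrature.sincQuad F.operator β k M N f)
      ≤ max 1 C * ((Real.sinh (Real.pi ^ 2 / (2 * k)))⁻¹ * Real.exp (-(Real.pi ^ 2 / (2 * k)))
        + Real.exp (-((β - max 0 s) * N * k)) + Real.exp (-((1 - β) * M * k)))
        * SincQuadrature.fracNorm F.operator t f := by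
    intro M N
    refine (hmain M N).2.trans ?_
    gcongr
    exact le_max_right _ _
  refine ⟨fun M N _ _ => ⟨(hmain M N).1, hmax M N⟩, fun M N hMe hNe => (hmax M N).trans ?_⟩
  have hbal : ∀ {d : ℝ}, 0 < d → ∀ L : ℕ, L = ⌈Real.pi ^ 2 / (2 * d * k ^ 2)⌉₊ →
      Real.exp (-(d * L * k)) ≤ Real.exp (-(Real.pi ^ 2 / (2 * k))) := by
    intro d hd L hL
    refine Real.exp_le_exp.2 (neg_le_neg ?_)
    have h := Nat.le_ceil (Real.pi ^ 2 / (2 * d * k ^ 2))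
    rw [← hL] at h
    calc Real.pi ^ 2 / (2 * k) = d * (Real.pi ^ 2 / (2 * d * k ^ 2)) * k := by field_simp
      _ ≤ _ := by gcongr
  have hM1 := hbal hM M hMe
  have hN1 := hbal hN N hNe
  -- both reciprocals are at least one, so their sum absorbs the factor two
  have h2 : 2 ≤ 1 / (β - max 0 s) + 1 / (1 - β) := by
    have e1 : 1 ≤ 1 / (β - max 0 s) :=
      (one_le_div hN).2 (by linarith [hβ.2, le_max_left 0 s])
    have e2 : 1 ≤ 1 / (1 - β) := (one_le_div hM).2 (by linarith [hβ.1])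
    linarith
  refine mul_le_mul_of_nonneg_right ?_ hfn
  rw [mul_assoc (max 1 C)]
  refine mul_le_mul_of_nonneg_left ?_ ((zero_le_one' ℝ).trans (le_max_left 1 C))
  have hq : 0 ≤ (Real.sinh (Real.pi ^ 2 / (2 * k)))⁻¹ * Real.exp (-(Real.pi ^ 2 / (2 * k))) := by
    positivity
  have he := Real.exp_pos (-(Real.pi ^ 2 / (2 * k)))
  nlinarith
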